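/- **Setting.** Let $G$ be a finite connected multigraph (loops and parallel edges allowed) with vertex set $V$, edge set $E$ and an arbitrary orientation of the edges, $e$ running from $e^-$ to $e^+$. Let $H_1=H_1(G,\mathbb Z)\subset C_1=C_1(G,\mathbb Z)$ be the kernel of $e\mapsto e^+-e^-$, let $g$ be its rank, $N=\mathrm{Hom}(H_1,\mathbb Z)$, and $N_A=\mathrm{Hom}(H_1,A)$ for a commutative ring $A$. Given elements $x_e\in A$ $(e\in E)$, let $[\cdot,\cdot]\colon C_1\times C_1\to A$ be the bilinear pairing with $[e,e]=x_e$ and $[e,e']=0$ for $e\neq e'$, let $\pi\colon C_1\to N_A$, $\pi(c)=[c,\cdot]|_{H_1}$, and $\Lambda=\pi(H_1)$. Let $n_e\in N$ be the functional sending $\gamma$ to the multiplicity of $e$ in $\gamma$, so that $\pi(e)=x_en_e$. **Universal Ceresa period.** Take $A=R=\mathbb Z[x_e : e\in E]$. Let $C_q$ be the free abelian group on the ordered simplices $(u_0,\dots,u_q)\in N_R^{q+1}$ modulo simultaneous translation of all vertices by an element of $\Lambda$, with the usual boundary; put $C_{1,q}=N\otimes_{\mathbb Z}C_q$ with $\partial(n\otimes\sigma)=n\otimes\partial\sigma$,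 and let $[-1]_*$ send $n\otimes(u_0,\dots,u_q)$ to $(-n)\otimes(-u_0,\dots,-u_q)$. For a vertex $v$ let $\delta_e$ be a path from $v$ to $e^-$ and $$\Phi_v=\sum_{e\in E}n_e\otimes(\pi(\delta_e),\pi(\delta_e+e)),\qquad \mathrm{Cer}_v(G)=\Phi_v-[-1]_*\Phi_v .$$ Let $\Theta\colon C_{1,2}\to\bigwedge^3_RN_R$, $\Theta(n\otimes(u_0,u_1,u_2))=n\wedge(u_1-u_0)\wedge(u_2-u_0)$, and let $\mathscr P$ be the image under $\Theta$ of the $(1,2)$-cycles. Then $\alpha(G)$ is the class of $\Theta(\Sigma)$ in $\bigwedge^3_RN_R/\mathscr P$ for any $\Sigma\in C_{1,2}$ with $\partial\Sigma=\mathrm{Cer}_v(G)$; it depends neither on $\Sigma$ nor on $v$. **Ceresa period of a tropical curve.** A length function $\ell\in\mathbb R_{>0}^E$ defines a tropical curve $C$ with model $(G,\ell)$ (an edge $e$ becomes a segment of length $\ell(e)$). Take $A=\mathbb R$, $x_e=\ell(e)$, so $\Lambda_C=\pi(H_1)$ is a lattice in $N_{\mathbb R}$ and $\mathrm{Jac}(C)=N_{\mathbb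 R}/\Lambda_C$. Let $S_{1,q}=N\otimes_{\mathbb Z}S_q(\mathrm{Jac}(C))$ with $S_\bullet$ the smooth singular chains. For a base point $v\in C$ let $\mathrm{Cer}_v(C)\in S_{1,1}$ be given by the formula above, with affine simplices and with paths in $C$ (paths that start inside an edge having real coefficients). With $\epsilon_1,\dots,\epsilon_g$ a basis of $N$ and $z_1,\dots,z_g$ the corresponding coordinates on $N_{\mathbb R}$, let $\Theta_C\colon S_{1,2}\to\bigwedge^3N_{\mathbb R}$, $$\Theta_C\Big(\sum_i n_i\epsilon_i\otimes\sigma\Big)=2\sum_{i<j<k}\int_\sigma\big(n_i\,dz_j\wedge dz_k-n_j\,dz_i\wedge dz_k+n_k\,dz_i\wedge dz_j\big)\;\epsilon_i\wedge\epsilon_j\wedge\epsilon_k ,$$ and let $\mathscr P_C$ be the image under $\Theta_C$ of the $(1,2)$-cycles. Then $\alpha(C)$ is the class of $\Theta_C(\Sigma)$ in $\bigwedge^3N_{\mathbb R}/\mathscr P_C$ for any $\Sigma\in S_{1,2}$ with $\partial\Sigma=\mathrm{Cer}_v(C)$. **Very general.** Let $\mathscr M_G^{\mathrm{tr}}=\mathbb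 R_{>0}^{E}/\mathrm{Aut}(G)$. A hypersurface in it is the image of the zero locus in $\mathbb R_{>0}^E$ of a nonconstant real polynomial. A property holds for a very general tropical curve overlying $G$ if it holds for every $\ell$ whose class lies outside some countable union of hypersurfaces. **Proposition.** Suppose $\alpha(G)\neq0$. Then a very general tropical curve $C$ overlying $G$ has $\alpha(C)\neq0$ (whatever the base point). Moreover there is a sequence $F_0,F_1,\dots$ of finite sets of polynomials in $\mathbb Z[x_e : e\in E]$, each containing a nonzero polynomial, such that for every $\ell\in\mathbb R_{>0}^E$, with associated curve $C$, and every base point, $\alpha(C)=0$ if and only if for some $n$ all polynomials in $F_n$ vanish at $\ell$. -/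

import Mathlib

open scoped TensorProduct ContDiff

noncomputable section

namespace CeresaPeriod

universe u v

/-! ### Multigraphs, simplicial chains and cycles -/

/-- A multigraph with vertex type `V` and edge type `E`, together with an (arbitrary) orientation:
the edge `e` runs from `tail e` (written `e⁻`) to `head e` (written `e⁺`).
Loops and parallel edges are allowed. -/
structure Multigraph (V : Type u) (E : Type v) where
  tail : E → V
  head : E → V

namespace Multigraph

variable {V : Type u} {E : Type v} (G : Multigraph V E)

/-- The graph is connected (as an unoriented graph, and in particular nonempty). -/
def Connected : Prop :=
  Nonempty V ∧ ∀ a b : V, Relation.EqvGen (fun p q => ∃ e, G.tail e = p ∧ G.head e = q) a b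

/-- The boundary map `C₁(G,ℤ) → C₀(G,ℤ)`, `e ↦ e⁺ - e⁻`. -/
def boundary₁ : (E →₀ ℤ) →ₗ[ℤ] (V →₀ ℤ) :=
  Finsupp.linearCombination ℤ fun e =>
    (Finsupp.single (G.head e) 1 - Finsupp.single (G.tail e) 1 : V →₀ ℤ)

/-- `H₁(G,ℤ) ⊆ C₁(G,ℤ)`. -/
def H₁ : Submodule ℤ (E →₀ ℤ) := LinearMap.ker G.boundary₁

/-- `N = H¹(G,ℤ) = Hom(H₁(G,ℤ),ℤ)`. -/
abbrev N : Type v := G.H₁ →ₗ[ℤ] ℤ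

/-- `N_A = H¹(G,A) = Hom(H₁(G,ℤ),A)` for a commutative ring `A`. -/
abbrev NExt (A : Type*) [CommRing A] : Type _ := G.H₁ →ₗ[ℤ] A

/-- The natural map `N → N_A`. -/
def incl (A : Type*) [CommRing A] : G.N →ₗ[ℤ] G.NExt A :=
  LinearMap.compRight ℤ (Algebra.linearMap ℤ A)

/-- `IsPath a b δ`: the 1-chain `δ` is the sum of the (signed) edges along a path (edge walk)
in the graph from `a` to `b`. -/
inductive IsPath (a : V) : V → (E →₀ ℤ) → Prop
  | nil : IsPath a a 0
  | forward {δ : E →₀ ℤ} (e : E) : IsPath a (G.tail e) δ →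
      IsPath a (G.head e) (δ + Finsupp.single e 1)
  | backward {δ : E →₀ ℤ} (e : E) : IsPath a (G.head e) δ →
      IsPath a (G.tail e) (δ - Finsupp.single e 1)

open Classical in
/-- A chosen path from `a` to `b` (there is one whenever the graph is connected). -/
def path (a b : V) : E →₀ ℤ := if h : ∃ δ, G.IsPath a b δ then h.choose else 0

/-! ### Length pairing and the lattice `Λ` -/

section Lengths

variable {A : Type*} [CommRing A] (x : E → A)

open Classical in
/-- The length pairing `C₁(G,ℤ) × C₁(G,ℤ) → A`, with `[e,e] = x e` and `[e,e'] = 0` for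
`e ≠ e'`. -/
def lengthPairing : (E →₀ ℤ) →ₗ[ℤ] (E →₀ ℤ) →ₗ[ℤ] A :=
  Finsupp.linearCombination ℤ fun e =>
    Finsupp.linearCombination ℤ fun e' => if e = e' then x e else 0

/-- `π : C₁(G,ℤ) → N_A`, `c ↦ [c,·]`. -/
def proj : (E →₀ ℤ) →ₗ[ℤ] G.NExt A :=
  LinearMap.lcomp ℤ A G.H₁.subtype ∘ₗ lengthPairing x

/-- `Λ = π(H₁(G,ℤ)) ⊆ N_A`. -/
def lattice : AddSubgroup (G.NExt A) :=
  (LinearMap.range (G.proj x ∘ₗ G.H₁.subtype)).toAddSubgroup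

/-- The element `x_e⁻¹ π(e)` of `N`, namely `γ ↦` multiplicity of `e` in `γ`
(see `smul_incl_edgeClass`). -/
def edgeClass (e : E) : G.N := Finsupp.lapply e ∘ₗ G.H₁.subtype

open Classical in
theorem smul_incl_edgeClass (e : E) :
    x e • G.incl A (G.edgeClass e) = G.proj x (Finsupp.single e 1) := by
  ext γ
  have h : G.proj x (Finsupp.single e 1) γ
      = Finsupp.linearCombination ℤ (fun e' => if e = e' then x e else 0) (γ : E →₀ ℤ) := by
    simp [proj, lengthPairing]
  rw [h, Finsupp.linearCombination_apply, Finsupp.sum, Finset.sum_eq_single e]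
  · simp [incl, edgeClass, mul_comm]
  · intro b _ hb
    simp [Ne.symm hb]
  · intro h
    simp [Finsupp.notMem_support_iff.mp h]

end Lengths

/-! ### The universal Jacobian and its chains -/

/-- `R = ℤ[x_e | e ∈ E(G)]`. -/
abbrev R (_ : Multigraph V E) : Type v := MvPolynomial E ℤ

/-- `N_R`. -/
abbrev NR : Type v := G.NExt G.R

/-- The universal projection `π : C₁(G,ℤ) → N_R`, with `x_e` as the length of `e`. -/
abbrev projU : (E →₀ ℤ) →ₗ[ℤ] G.NR := G.proj (MvPolynomial.X : E → G.R)

/-- The universal lattice `Λ ⊆ N_R`. -/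
abbrev latticeU : AddSubgroup G.NR := G.lattice (MvPolynomial.X : E → G.R)

/-- Ordered `q`-simplices in `N_R` are identified up to simultaneous translation by `Λ`. -/
def simplexSetoid (q : ℕ) : Setoid (Fin (q + 1) → G.NR) where
  r a b := ∃ c ∈ G.latticeU, ∀ i, b i = a i + c
  iseqv :=
    { refl := fun a => ⟨0, zero_mem _, fun i => by simp⟩
      symm := by
        rintro a b ⟨c, hc, h⟩
        exact ⟨-c, neg_mem hc, fun i => by simp [h i]⟩
      trans := by
        rintro a b d ⟨c, hc, h⟩ ⟨c', hc', h'⟩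
        exact ⟨c + c', add_mem hc hc', fun i => by rw [h' i, h i, add_assoc]⟩ }

/-- Ordered `q`-simplices of the universal Jacobian. -/
def Simplex (q : ℕ) : Type v := Quotient (G.simplexSetoid q)

/-- The class of the ordered simplex `(u₀,…,u_q)`. -/
def simplex {q : ℕ} (u : Fin (q + 1) → G.NR) : G.Simplex q := Quotient.mk (G.simplexSetoid q) u

/-- The `i`-th face, omitting the `i`-th vertex. -/
def face {q : ℕ} (i : Fin (q + 2)) : G.Simplex (q + 1) → G.Simplex q :=
  Quotient.map' (s₁ := G.simplexSetoid (q + 1)) (s₂ := G.simplexSetoid q)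
    (fun u => u ∘ i.succAbove) (by
      rintro a b ⟨c, hc, h⟩
      exact ⟨c, hc, fun j => h _⟩)

/-- The simplex `(-u₀,…,-u_q)`. -/
def negSimplex {q : ℕ} : G.Simplex q → G.Simplex q :=
  Quotient.map' (s₁ := G.simplexSetoid q) (s₂ := G.simplexSetoid q) (fun u => -u) (by
      rintro a b ⟨c, hc, h⟩
      exact ⟨-c, neg_mem hc, fun j => by simp [h j, add_comm]⟩)

/-- `C_q(Jac(G))`, the free abelian group on ordered `q`-simplices. -/
abbrev Chain (q : ℕ) : Type v := G.Simplex q →₀ ℤ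

/-- `C_{1,q}(Jac(G)) = N ⊗ C_q(Jac(G))`. -/
abbrev TChain (q : ℕ) : Type v := G.N ⊗[ℤ] G.Chain q

/-- `∂ : C_{q+1} → C_q`. -/
def boundary (q : ℕ) : G.Chain (q + 1) →ₗ[ℤ] G.Chain q :=
  ∑ i : Fin (q + 2), (-1 : ℤ) ^ (i : ℕ) • Finsupp.lmapDomain ℤ ℤ (G.face i)

/-- `∂ : C_{1,q+1} → C_{1,q}`, `n ⊗ σ ↦ n ⊗ ∂σ`. -/
def tBoundary (q : ℕ) : G.TChain (q + 1) →ₗ[ℤ] G.TChain q :=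
  LinearMap.lTensor G.N (G.boundary q)

/-- `[-1]_* : C_{1,q} → C_{1,q}`, `n ⊗ (u₀,…,u_q) ↦ (-n) ⊗ (-u₀,…,-u_q)`. -/
def negPush (q : ℕ) : G.TChain q →ₗ[ℤ] G.TChain q :=
  TensorProduct.map (-LinearMap.id) (Finsupp.lmapDomain ℤ ℤ G.negSimplex)

/-- The `(1,1)`-chain `Φ_a(e) = x_e⁻¹π(e) ⊗ (π(δ_e), π(δ_e + e))`, with `δ_e` a path from `a`
to `e⁻`. -/
def abelJacobiEdge (a : V) (e : E) : G.TChain 1 :=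
  G.edgeClass e ⊗ₜ Finsupp.single (G.simplex
    ![G.projU (G.path a (G.tail e)), G.projU (G.path a (G.tail e) + Finsupp.single e 1)]) 1

/-- The universal Ceresa cycle based at the vertex `a`. -/
def ceresaCycle [Fintype E] (a : V) : G.TChain 1 :=
  (∑ e, G.abelJacobiEdge a e) - G.negPush 1 (∑ e, G.abelJacobiEdge a e)

/-- `N_R^{∧3}`, the exterior power over `R`. -/
abbrev WedgeR : Type v := ⋀[G.R]^3 G.NR

/-- For fixed `p, q ∈ N_A`, the map `N → N_A^{∧3}`, `n ↦ n ∧ p ∧ q`. -/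
def wedgeLeft (A : Type*) [CommRing A] (p q : G.NExt A) : G.N →ₗ[ℤ] ⋀[A]^3 (G.NExt A) :=
  AddMonoidHom.toIntLinearMap
    { toFun := fun n => exteriorPower.ιMulti A 3 ![G.incl A n, p, q]
      map_zero' := by
        rw [map_zero]
        exact (exteriorPower.ιMulti A 3).map_coord_zero (0 : Fin 3) rfl
      map_add' := fun m n => by
        rw [map_add]
        exact (exteriorPower.ιMulti A 3).toMultilinearMap.cons_add ![p, q] _ _ }

/-- `Θ` on a simplex: `n ↦ n ∧ (u₁ - u₀) ∧ (u₂ - u₀)`. -/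
def thetaSimplex : G.Simplex 2 → (G.N →ₗ[ℤ] G.WedgeR) :=
  Quotient.lift (s := G.simplexSetoid 2)
    (fun u => G.wedgeLeft G.R (u 1 - u 0) (u 2 - u 0)) (by
      rintro a b ⟨c, _, h⟩
      simp [h])

/-- `Θ : C_{1,2}(Jac(G)) → N_R^{∧3}`. -/
def theta : G.TChain 2 →ₗ[ℤ] G.WedgeR :=
  TensorProduct.lift (Finsupp.linearCombination ℤ G.thetaSimplex).flip

/-- `𝒫 = Θ(H_{1,2}(Jac(G)))`, the image under `Θ` of the `(1,2)`-cycles. -/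
def periods : AddSubgroup G.WedgeR :=
  ((LinearMap.ker (G.tBoundary 1)).map G.theta).toAddSubgroup

open Classical in
/-- The universal Ceresa period `α(G) ∈ N_R^{∧3}/𝒫`, computed with the base vertex `a`: the class
of `Θ(Σ)` for any `Σ` with `∂Σ = Cer_a(G)` (and `0` if there were no such `Σ`). -/
def ceresaPeriod [Fintype E] (a : V) : G.WedgeR ⧸ G.periods :=
  if h : ∃ S : G.TChain 2, G.tBoundary 1 S = G.ceresaCycle a then
    QuotientAddGroup.mk (G.theta h.choose)
  else 0

/-! ### Tropical curves overlying `G` -/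

/-- Length functions `E(G) → ℝ_{>0}`; each presents the tropical curve with model `(G,ℓ)`. -/
abbrev Length (_ : Multigraph V E) : Type v := {l : E → ℝ // ∀ e, 0 < l e}

variable (l : G.Length)

/-- `N_ℝ = H¹(C,ℝ)`. -/
abbrev NReal : Type v := G.NExt ℝ

/-- `π_C : C₁(G,ℤ) → N_ℝ`. -/
abbrev projC : (E →₀ ℤ) →ₗ[ℤ] G.NReal := G.proj l.1

/-- The tropical Jacobian `Jac(C) = N_ℝ/Λ_C`. -/
abbrev Jac : Type v := G.NReal ⧸ G.lattice l.1

/-- A function from `ℝ^{q+1}` to the finite-dimensional real vector space `N_ℝ = Hom(H₁(G,ℤ),ℝ)`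
is smooth if all its coordinates `t ↦ f(t)(γ)` are. -/
def IsSmooth {q : ℕ} (f : (Fin (q + 1) → ℝ) → G.NReal) : Prop :=
  ∀ γ : G.H₁, ContDiff ℝ ∞ fun t => f t γ

/-- Smooth singular `q`-simplices `Δ^q → Jac(C)`: the maps that lift to a map `Δ^q → N_ℝ` which is
the restriction of a smooth map on `ℝ^{q+1}`. (As `Δ^q` is simply connected and compact, every
smooth map to the torus `N_ℝ/Λ_C` has such a lift.) -/
@[ext]
structure SmoothSimplex (q : ℕ) : Type v where
  toFun : stdSimplex ℝ (Fin (q + 1)) → G.Jac l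
  smooth : ∃ f : (Fin (q + 1) → ℝ) → G.NReal,
    G.IsSmooth f ∧ ∀ t, toFun t = QuotientAddGroup.mk (f t.1)

namespace SmoothSimplex

variable {G l}

/-- A smooth lift of a smooth simplex to the universal cover; it is unique on `Δ^q` up to
translation by an element of the lattice. -/
def lift {q : ℕ} (s : G.SmoothSimplex l q) : (Fin (q + 1) → ℝ) → G.NReal := s.smooth.choose

/-- The `i`-th face of a smooth simplex. -/
def face {q : ℕ} (i : Fin (q + 2)) (s : G.SmoothSimplex l (q + 1)) : G.SmoothSimplex l q :=
  ⟨fun t => s.toFun (stdSimplex.map i.succAbove t), by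
    obtain ⟨f, hf, h⟩ := s.smooth
    refine ⟨fun t => f (FunOnFinite.linearMap ℝ ℝ i.succAbove t), fun γ => ?_, fun t => h _⟩
    exact (hf γ).comp
      (LinearMap.toContinuousLinearMap (FunOnFinite.linearMap ℝ ℝ i.succAbove)).contDiff⟩

/-- The composition of a smooth simplex with `[-1] : Jac(C) → Jac(C)`. -/
def neg {q : ℕ} (s : G.SmoothSimplex l q) : G.SmoothSimplex l q :=
  ⟨fun t => -s.toFun t, by
    obtain ⟨f, hf, h⟩ := s.smooth
    refine ⟨fun t => -f t, fun γ => (hf γ).neg, fun t => ?_⟩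
    rw [h t]; rfl⟩

variable (l) in
/-- The affine simplex `(u₀,…,u_q)`. -/
def affine {q : ℕ} (p : Fin (q + 1) → G.NReal) : G.SmoothSimplex l q :=
  ⟨fun t => QuotientAddGroup.mk (∑ i, t.1 i • p i),
    fun t => ∑ i, t i • p i, fun γ => by
      simp only [LinearMap.sum_apply, LinearMap.smul_apply, smul_eq_mul]
      fun_prop, fun _ => rfl⟩

end SmoothSimplex

/-- `S_q(Jac(C))`. -/
abbrev SChain (q : ℕ) : Type v := G.SmoothSimplex l q →₀ ℤ

/-- `S_{1,q}(Jac(C)) = N ⊗ S_q(Jac(C))`. -/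
abbrev STChain (q : ℕ) : Type v := G.N ⊗[ℤ] G.SChain l q

/-- `∂ : S_{q+1} → S_q`. -/
def sBoundary (q : ℕ) : G.SChain l (q + 1) →ₗ[ℤ] G.SChain l q :=
  ∑ i : Fin (q + 2), (-1 : ℤ) ^ (i : ℕ) • Finsupp.lmapDomain ℤ ℤ (SmoothSimplex.face i)

/-- `∂ : S_{1,q+1} → S_{1,q}`. -/
def stBoundary (q : ℕ) : G.STChain l (q + 1) →ₗ[ℤ] G.STChain l q :=
  LinearMap.lTensor G.N (G.sBoundary l q)

/-- `[-1]_* : S_{1,q} → S_{1,q}`. -/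
def sNegPush (q : ℕ) : G.STChain l q →ₗ[ℤ] G.STChain l q :=
  TensorProduct.map (-LinearMap.id) (Finsupp.lmapDomain ℤ ℤ SmoothSimplex.neg)

/-- Points of the tropical curve with model `(G,ℓ)`: vertices, and the points of the segments
`[0,ℓ(e)]` (an endpoint of a segment being another name of a vertex). -/
inductive CurvePoint : Type (max u v)
  | vertex (a : V) : CurvePoint
  | onEdge (e : E) (t : Set.Icc (0 : ℝ) (l.1 e)) : CurvePoint

namespace CurvePoint

variable {G l}

/-- A vertex from which paths starting at the point `p` are continued: `p` itself, or the tail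
of the edge on which `p` lies. -/
def root : G.CurvePoint l → V
  | vertex a => a
  | onEdge e _ => G.tail e

/-- The value of `π_C` on the segment from `p` to `root p`: for the point at distance `t` from
`e⁻` on `e`, this is `-(t/ℓ(e)) π_C(e)`. -/
def offset : G.CurvePoint l → G.NReal
  | vertex _ => 0
  | onEdge e t => -((t.1 / l.1 e) • G.projC l (Finsupp.single e 1))

end CurvePoint

/-- `π_C(δ)` for a path `δ` in the curve from the point `p` to the vertex `b`, a lift to `N_ℝ` of
the Abel–Jacobi image of `b`. -/
def abelJacobiLift (p : G.CurvePoint l) (b : V) : G.NReal :=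
  p.offset + G.projC l (G.path p.root b)

/-- The edge `e` contributes the `(1,1)`-chain `ℓ(e)⁻¹π(e) ⊗ (π(δ_e), π(δ_e + e))` to the class of
the push-forward of the curve by the Abel–Jacobi map based at `p`, where `δ_e` is a path from `p`
to `e⁻`. -/
def sAbelJacobiEdge (p : G.CurvePoint l) (e : E) : G.STChain l 1 :=
  G.edgeClass e ⊗ₜ Finsupp.single (SmoothSimplex.affine l
    ![G.abelJacobiLift l p (G.tail e),
      G.abelJacobiLift l p (G.tail e) + G.projC l (Finsupp.single e 1)]) 1

/-- The tropical Ceresa cycle `Cer_p(C)` as a tropical `(1,1)`-chain. -/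
def tropicalCeresaCycle [Fintype E] (p : G.CurvePoint l) : G.STChain l 1 :=
  (∑ e, G.sAbelJacobiEdge l p e) - G.sNegPush l 1 (∑ e, G.sAbelJacobiEdge l p e)

section Integration

variable [Finite E]

instance : Module.Finite ℤ G.H₁ := inferInstanceAs (Module.Finite ℤ (LinearMap.ker G.boundary₁))

instance : Module.Free ℤ G.H₁ := inferInstanceAs (Module.Free ℤ (LinearMap.ker G.boundary₁))

/-- The genus `g`, the rank of `H₁(G,ℤ)`. -/
def genus : ℕ := Module.finrank ℤ G.H₁

/-- A basis `γ₁,…,γ_g` of `H₁(G,ℤ)`. The coordinate functions on `N_ℝ` that belong to the dual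
basis `ε₁,…,ε_g` of `N` are `z_i(u) = u(γ_i)`. -/
def cycleBasis : Module.Basis (Fin G.genus) ℤ G.H₁ := Module.finBasis ℤ G.H₁

/-- The dual basis `ε₁,…,ε_g` of `N`. -/
def cocycleBasis (i : Fin G.genus) : G.N := G.cycleBasis.coord i

/-- `∫_σ dz_i ∧ dz_j = ∫_{Δ²} σ^*(dz_i ∧ dz_j)`, where `Δ²` is parametrized (compatibly with its
orientation) by `(a,b) ↦ (1 - a - b, a, b)` for `a, b ≥ 0`, `a + b ≤ 1`. -/
def integral₂ (s : G.SmoothSimplex l 2) (i j : Fin G.genus) : ℝ :=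
  let z : Fin G.genus → ℝ × ℝ → ℝ := fun k p =>
    s.lift ![1 - p.1 - p.2, p.1, p.2] (G.cycleBasis k)
  ∫ p in {p : ℝ × ℝ | 0 ≤ p.1 ∧ 0 ≤ p.2 ∧ p.1 + p.2 ≤ 1},
    (fderiv ℝ (z i) p (1, 0) * fderiv ℝ (z j) p (0, 1)
      - fderiv ℝ (z i) p (0, 1) * fderiv ℝ (z j) p (1, 0))

/-- `N_ℝ^{∧3}`. -/
abbrev WedgeReal : Type v := ⋀[ℝ]^3 G.NReal

/-- `ε_i ∧ ε_j ∧ ε_k ∈ N_ℝ^{∧3}`. -/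
def wedgeBasis (i j k : Fin G.genus) : G.WedgeReal :=
  exteriorPower.ιMulti ℝ 3 ![G.incl ℝ (G.cocycleBasis i), G.incl ℝ (G.cocycleBasis j),
    G.incl ℝ (G.cocycleBasis k)]

/-- `Θ_C` on a smooth simplex `σ`: the element `n = ∑ n_i ε_i` is sent to
`2 ∑_{i<j<k} ∫_σ (n_i dz_j ∧ dz_k - n_j dz_i ∧ dz_k + n_k dz_i ∧ dz_j) ε_i ∧ ε_j ∧ ε_k`. -/
def sThetaSimplex (s : G.SmoothSimplex l 2) : G.N →ₗ[ℤ] G.WedgeReal :=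
  AddMonoidHom.toIntLinearMap
    { toFun := fun n =>
        (2 : ℝ) • ∑ I : Fin G.genus × Fin G.genus × Fin G.genus with I.1 < I.2.1 ∧ I.2.1 < I.2.2,
          ((n (G.cycleBasis I.1) : ℝ) * G.integral₂ l s I.2.1 I.2.2
            - (n (G.cycleBasis I.2.1) : ℝ) * G.integral₂ l s I.1 I.2.2
            + (n (G.cycleBasis I.2.2) : ℝ) * G.integral₂ l s I.1 I.2.1) •
              G.wedgeBasis I.1 I.2.1 I.2.2
      map_zero' := by simp
      map_add' := fun m n => by
        rw [← smul_add, ← Finset.sum_add_distrib]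
        congr 1
        refine Finset.sum_congr rfl fun I _ => ?_
        rw [← add_smul]
        congr 1
        simp only [LinearMap.add_apply, Int.cast_add]
        ring }

/-- The integration map `Θ_C : S_{1,2}(Jac(C)) → N_ℝ^{∧3}`. -/
def sTheta : G.STChain l 2 →ₗ[ℤ] G.WedgeReal :=
  TensorProduct.lift (Finsupp.linearCombination ℤ (G.sThetaSimplex l)).flip

/-- `𝒫_C = Θ_C(H_{1,2}(Jac(C)))`, the image under `Θ_C` of the tropical `(1,2)`-cycles. -/
def tropicalPeriods : AddSubgroup G.WedgeReal :=
  ((LinearMap.ker (G.stBoundary l 1)).map (G.sTheta l)).toAddSubgroup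

end Integration

open Classical in
/-- The Ceresa period `α(C) ∈ N_ℝ^{∧3}/𝒫_C` of the tropical curve with model `(G,ℓ)`, computed
with the base point `p`: the class of `Θ_C(Σ)` for any `Σ` with `∂Σ = Cer_p(C)` (and `0` if there
were no such `Σ`). -/
def tropicalCeresaPeriod [Fintype E] (p : G.CurvePoint l) : G.WedgeReal ⧸ G.tropicalPeriods l :=
  if h : ∃ S : G.STChain l 2, G.stBoundary l 1 S = G.tropicalCeresaCycle l p then
    QuotientAddGroup.mk (G.sTheta l h.choose)
  else 0

/-! ### Moduli of tropical curves overlying `G` -/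

/-- Automorphisms of the (unoriented) multigraph. -/
structure Auto where
  onV : V ≃ V
  onE : E ≃ E
  compat : ∀ e, s(G.tail (onE e), G.head (onE e)) = s(onV (G.tail e), onV (G.head e))

/-- Two length functions are equivalent if an automorphism of the graph carries one to the
other. -/
def lengthSetoid : Setoid G.Length where
  r l l' := ∃ φ : G.Auto, ∀ e, l'.1 (φ.onE e) = l.1 e
  iseqv :=
    { refl := fun l => ⟨⟨Equiv.refl _, Equiv.refl _, fun _ => rfl⟩, fun _ => rfl⟩
      symm := by
        rintro l l' ⟨φ, h⟩
        refine ⟨⟨φ.onV.symm, φ.onE.symm, fun e => ?_⟩, fun e => by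
          simpa using (h (φ.onE.symm e)).symm⟩
        apply Sym2.map.injective φ.onV.injective
        simpa using (φ.compat (φ.onE.symm e)).symm
      trans := by
        rintro l l' l'' ⟨φ, h⟩ ⟨ψ, h'⟩
        refine ⟨⟨φ.onV.trans ψ.onV, φ.onE.trans ψ.onE, fun e => ?_⟩, fun e => by
          simp [h', h]⟩
        have := congrArg (Sym2.map ψ.onV) (φ.compat e)
        simp only [Sym2.map_mk] at this
        simp only [Equiv.trans_apply, ψ.compat]
        exact this }

/-- `ℳ_G^tr = ℝ_{>0}^{E(G)}/Aut(G)`. -/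
def Moduli : Type v := Quotient G.lengthSetoid

/-- The point of `ℳ_G^tr` given by a length function. -/
def toModuli (l : G.Length) : G.Moduli := Quotient.mk G.lengthSetoid l

/-- Hypersurfaces in `ℳ_G^tr`: the images of the zero loci in `ℝ_{>0}^{E(G)}` of nonconstant
polynomials. -/
def IsHypersurface (Z : Set G.Moduli) : Prop :=
  ∃ f : MvPolynomial E ℝ, f.totalDegree ≠ 0 ∧
    Z = G.toModuli '' {l | MvPolynomial.eval l.1 f = 0}

/-- The property `P` holds for a very general tropical curve overlying `G`. -/
def VeryGeneral (P : G.Length → Prop) : Prop :=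
  ∃ 𝓗 : Set (Set G.Moduli), 𝓗.Countable ∧ (∀ Z ∈ 𝓗, G.IsHypersurface Z) ∧
    ∀ l : G.Length, G.toModuli l ∉ ⋃₀ 𝓗 → P l

end Multigraph

end CeresaPeriod

end

noncomputable section

namespace CeresaPeriod

/-! ### Green's formula on the standard triangle -/

section Green

open MeasureTheory intervalIntegral

/-! Substituting `ℓ(e)` for `x_e` turns universal chains into affine chains on the tropical Jacobian
and commutes with the boundary, with `[-1]_*` and with the Θ-maps. If `S` bounds the universal
Ceresa cycle, its specialization therefore bounds the tropical one based at the same vertex, and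
`α(C)` is represented by the value of `Θ(S)` at `ℓ`.

The main point is `mem_tropicalPeriods_iff`: smooth singular cycles have no periods beyond the
values at `ℓ` of the universal periods. Choosing a lift to `N_ℝ` of every point of the Jacobian
attaches to each smooth edge a cycle in `H₁`, its period, and this is a 1-cocycle. By Green's
formula the integral of `dz_i ∧ dz_j` over a triangle is the cup product of two such cocycles up to
a coboundary (`integral₂_eq_cup`). Over a 2-cycle only integers `cupCoeff z a b` remain,
antisymmetric in `a` and `b`, so the period is an integral combination of elements `2 n ∧ π(γ_a) ∧
π(γ_b)` with `a < b`. Each of these is the value of the period of a universal torus.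

Hence `α(C) = 0` if and only if some `w` in `𝒫` has all coordinates of `Θ(S) - w` vanishing at `ℓ`.
These coordinates are integral polynomials, `𝒫` is countable, and `Θ(S) - w` is never zero because
`α(G) ≠ 0`. This gives the sets `F_n`; one nonzero polynomial from each gives the hypersurfaces to
be avoided.

Passing to another base point adds prisms over the edges (`exists_bounding_chain`). Their Θ-value
vanishes, as one side of the prism over `e` is parallel to the coefficient `n_e`. -/

/-- The standard triangle in the plane. -/
abbrev triangle : Set (ℝ × ℝ) := {p : ℝ × ℝ | 0 ≤ p.1 ∧ 0 ≤ p.2 ∧ p.1 + p.2 ≤ 1}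

theorem isCompact_triangle : IsCompact triangle := by
  refine (isCompact_Icc (a := ((0 : ℝ), (0 : ℝ))) (b := (1, 1))).of_isClosed_subset ?_ ?_
  · exact (isClosed_le continuous_const continuous_fst).inter
      ((isClosed_le continuous_const continuous_snd).inter
        (isClosed_le (continuous_fst.add continuous_snd) continuous_const))
  · rintro ⟨a, b⟩ ⟨h₁, h₂, h₃⟩
    simp only [Set.mem_Icc, Prod.mk_le_mk] at *
    exact ⟨⟨h₁, h₂⟩, by linarith, by linarith⟩

/-- Lifts of a simplex are determined only on the simplex; this makes their derivatives well defined
there, boundary points included. -/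
theorem uniqueDiffOn_triangle : UniqueDiffOn ℝ triangle := by
  apply uniqueDiffOn_convex
  · have h : triangle = {p : ℝ × ℝ | 0 ≤ LinearMap.fst ℝ ℝ ℝ p} ∩
        ({p | 0 ≤ LinearMap.snd ℝ ℝ ℝ p} ∩
          {p | (LinearMap.fst ℝ ℝ ℝ + LinearMap.snd ℝ ℝ ℝ) p ≤ 1}) := rfl
    rw [h]
    exact (convex_halfSpace_ge (LinearMap.isLinear _) _).inter
      ((convex_halfSpace_ge (LinearMap.isLinear _) _).inter
        (convex_halfSpace_le (LinearMap.isLinear _) _))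
  · refine ⟨(1 / 4, 1 / 4), mem_interior.2
      ⟨{p | 0 < p.1 ∧ 0 < p.2 ∧ p.1 + p.2 < 1}, ?_, ?_, ?_⟩⟩
    · rintro p ⟨h₁, h₂, h₃⟩
      exact ⟨h₁.le, h₂.le, h₃.le⟩
    · exact (isOpen_lt continuous_const continuous_fst).inter
        ((isOpen_lt continuous_const continuous_snd).inter
          (isOpen_lt (continuous_fst.add continuous_snd) continuous_const))
    · norm_num

theorem setIntegral_triangle {F : ℝ × ℝ → ℝ} (hF : Continuous F) :
    ∫ p in triangle, F p = ∫ a in (0 : ℝ)..1, ∫ b in (0 : ℝ)..(1 - a), F (a, b) := by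
  have hm : MeasurableSet triangle := isCompact_triangle.isClosed.measurableSet
  have hi : Integrable (triangle.indicator F) (volume.prod volume) := by
    rw [← Measure.volume_eq_prod, integrable_indicator_iff hm]
    exact hF.continuousOn.integrableOn_compact isCompact_triangle
  rw [← MeasureTheory.integral_indicator hm, Measure.volume_eq_prod, integral_prod _ hi,
    intervalIntegral.integral_of_le zero_le_one, ← integral_Icc_eq_integral_Ioc,
    ← MeasureTheory.integral_indicator measurableSet_Icc]
  congr 1
  ext a
  by_cases ha : a ∈ Set.Icc (0 : ℝ) 1
  · rw [Set.indicator_of_mem ha, intervalIntegral.integral_of_le (by linarith [ha.2]),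
      ← integral_Icc_eq_integral_Ioc,
      ← MeasureTheory.integral_indicator measurableSet_Icc]
    congr 1
    ext b
    have hb : (a, b) ∈ triangle ↔ b ∈ Set.Icc 0 (1 - a) :=
      ⟨fun h => ⟨h.2.1, by linarith [h.2.2]⟩, fun h => ⟨ha.1, h.1, by linarith [h.2]⟩⟩
    by_cases h : (a, b) ∈ triangle
    · rw [Set.indicator_of_mem h, Set.indicator_of_mem (hb.1 h)]
    · rw [Set.indicator_of_notMem h, Set.indicator_of_notMem (fun h' => h (hb.2 h'))]
  · rw [Set.indicator_of_notMem ha]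
    have h0 : ∀ b, triangle.indicator F (a, b) = 0 := fun b => by
      refine Set.indicator_of_notMem (fun h => ha ?_) _
      obtain ⟨h₁, h₂, h₃⟩ := h
      simp only at h₁ h₂ h₃
      exact ⟨h₁, by linarith⟩
    simp [h0]

theorem setIntegral_triangle_swap {F : ℝ × ℝ → ℝ} (hF : Continuous F) :
    ∫ p in triangle, F p = ∫ b in (0 : ℝ)..1, ∫ a in (0 : ℝ)..(1 - b), F (a, b) := by
  refine Eq.trans ?_ (setIntegral_triangle (F := F ∘ Prod.swap) (hF.comp continuous_swap))
  have hp : MeasurePreserving (Prod.swap : ℝ × ℝ → ℝ × ℝ) volume volume :=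
    Measure.measurePreserving_swap
  rw [← hp.setIntegral_preimage_emb MeasurableEquiv.prodComm.measurableEmbedding F triangle]
  congr 2
  ext ⟨a, b⟩
  simp only [Set.mem_preimage, Set.mem_ofPred_eq, Prod.swap_prod_mk]
  constructor <;> rintro ⟨h₁, h₂, h₃⟩ <;> exact ⟨h₂, h₁, by linarith⟩

theorem hasDerivAt_fst {F : ℝ × ℝ → ℝ} (hF : Differentiable ℝ F) (a b : ℝ) :
    HasDerivAt (fun a => F (a, b)) (fderiv ℝ F (a, b) (1, 0)) a :=
  (hF (a, b)).hasFDerivAt.comp_hasDerivAt a ((hasDerivAt_id a).prodMk (hasDerivAt_const a b))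

theorem hasDerivAt_snd {F : ℝ × ℝ → ℝ} (hF : Differentiable ℝ F) (a b : ℝ) :
    HasDerivAt (fun b => F (a, b)) (fderiv ℝ F (a, b) (0, 1)) b :=
  (hF (a, b)).hasFDerivAt.comp_hasDerivAt b ((hasDerivAt_const b a).prodMk (hasDerivAt_id b))

theorem setIntegral_triangle_fderiv_fst {F : ℝ × ℝ → ℝ} (hF : ContDiff ℝ 1 F) :
    ∫ p in triangle, fderiv ℝ F p (1, 0) = ∫ b in (0 : ℝ)..1, (F (1 - b, b) - F (0, b)) := by
  have hc : Continuous fun p => fderiv ℝ F p (1, 0) :=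
    (hF.continuous_fderiv one_ne_zero).clm_apply continuous_const
  rw [setIntegral_triangle_swap hc]
  congr 1
  ext b
  exact integral_eq_sub_of_hasDerivAt
    (fun a _ => hasDerivAt_fst (hF.differentiable one_ne_zero) a b)
    ((hc.comp (by fun_prop : Continuous fun a : ℝ => (a, b))).intervalIntegrable _ _)

theorem setIntegral_triangle_fderiv_snd {F : ℝ × ℝ → ℝ} (hF : ContDiff ℝ 1 F) :
    ∫ p in triangle, fderiv ℝ F p (0, 1) = ∫ a in (0 : ℝ)..1, (F (a, 1 - a) - F (a, 0)) := by
  have hc : Continuous fun p => fderiv ℝ F p (0, 1) :=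
    (hF.continuous_fderiv one_ne_zero).clm_apply continuous_const
  rw [setIntegral_triangle hc]
  congr 1
  ext a
  exact integral_eq_sub_of_hasDerivAt
    (fun b _ => hasDerivAt_snd (hF.differentiable one_ne_zero) a b)
    ((hc.comp (by fun_prop : Continuous fun b : ℝ => (a, b))).intervalIntegrable _ _)

/-- The integral of `f dh` along the unit interval. -/
def lineIntegral (f h : ℝ → ℝ) : ℝ := ∫ t in (0 : ℝ)..1, f t * deriv h t

/-- Green's formula for the form `df ∧ dh` on the standard triangle. -/
theorem setIntegral_triangle_wedge {f h : ℝ × ℝ → ℝ} (hf : ContDiff ℝ ∞ f)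
    (hh : ContDiff ℝ ∞ h) :
    ∫ p in triangle, (fderiv ℝ f p (1, 0) * fderiv ℝ h p (0, 1)
        - fderiv ℝ f p (0, 1) * fderiv ℝ h p (1, 0)) =
      lineIntegral (fun t => f (1 - t, t)) (fun t => h (1 - t, t))
        - lineIntegral (fun t => f (0, t)) (fun t => h (0, t))
        + lineIntegral (fun t => f (t, 0)) (fun t => h (t, 0)) := by
  have hdf : Differentiable ℝ f := hf.differentiable (by simp)
  have hdh : Differentiable ℝ h := hh.differentiable (by simp)
  have hh' : ContDiff ℝ 1 (fderiv ℝ h) := hh.fderiv_right (WithTop.coe_le_coe.2 le_top : ((2 : ℕ∞) : WithTop ℕ∞) ≤ ∞)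
  have hf1 : ContDiff ℝ 1 f := hf.of_le (mod_cast le_top)
  have hpart : ∀ w : ℝ × ℝ, ContDiff ℝ 1 fun p => f p * fderiv ℝ h p w := fun w =>
    hf1.mul (hh'.clm_apply contDiff_const)
  have hfd : ∀ w v p, fderiv ℝ (fun p => f p * fderiv ℝ h p w) p v =
      fderiv ℝ f p v * fderiv ℝ h p w + f p * fderiv ℝ (fderiv ℝ h) p v w := by
    intro w v p
    have h1 := (hdf p).hasFDerivAt.mul
      (((hh'.differentiable one_ne_zero) p).hasFDerivAt.clm_apply (hasFDerivAt_const w p))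
    change fderiv ℝ (f * fun p => fderiv ℝ h p w) p v = _
    rw [h1.fderiv]
    simp
    ring
  have hsymm : ∀ p v w, fderiv ℝ (fderiv ℝ h) p v w = fderiv ℝ (fderiv ℝ h) p w v :=
    fun p v w => (hh.contDiffAt.isSymmSndFDerivAt (by
      simp only [minSmoothness_of_isRCLikeNormedField]
      exact WithTop.coe_le_coe.2 le_top)) v w
  have hint : ∀ w v, IntegrableOn (fun p => fderiv ℝ (fun p => f p * fderiv ℝ h p w) p v)
      triangle := fun w v =>
    (((hpart w).continuous_fderiv one_ne_zero).clm_apply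
      continuous_const).continuousOn.integrableOn_compact isCompact_triangle
  -- This is `df ∧ dh = d(f dh)`: the second derivatives of `h` cancel by symmetry.
  have key : ∫ p in triangle, (fderiv ℝ f p (1, 0) * fderiv ℝ h p (0, 1)
        - fderiv ℝ f p (0, 1) * fderiv ℝ h p (1, 0)) =
      (∫ p in triangle, fderiv ℝ (fun p => f p * fderiv ℝ h p (0, 1)) p (1, 0))
        - ∫ p in triangle, fderiv ℝ (fun p => f p * fderiv ℝ h p (1, 0)) p (0, 1) := by
    rw [← integral_sub (hint _ _) (hint _ _)]
    congr 1
    ext p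
    rw [hfd, hfd, hsymm p (1, 0) (0, 1)]
    ring
  rw [key, setIntegral_triangle_fderiv_fst (hpart _), setIntegral_triangle_fderiv_snd (hpart _)]
  have hcf := hf.continuous
  have hcp : ∀ w, Continuous fun p => fderiv ℝ h p w := fun w =>
    hh'.continuous.clm_apply continuous_const
  have hdiag : ∀ t, deriv (fun t => h (1 - t, t)) t =
      fderiv ℝ h (1 - t, t) (0, 1) - fderiv ℝ h (1 - t, t) (1, 0) := by
    intro t
    have h1 : HasDerivAt (fun t : ℝ => ((1 - t, t) : ℝ × ℝ)) (-1, 1) t :=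
      ((hasDerivAt_id t).const_sub 1).prodMk (hasDerivAt_id t)
    have h2 := HasFDerivAt.comp_hasDerivAt (f := fun t : ℝ => ((1 - t, t) : ℝ × ℝ)) t
      (hdh (1 - t, t)).hasFDerivAt h1
    rw [show (fun t => h (1 - t, t)) = h ∘ fun t => (1 - t, t) from rfl, h2.deriv, ← map_sub]
    simp
  have hII : ∀ (w : ℝ × ℝ) (c : ℝ → ℝ × ℝ), Continuous c →
      IntervalIntegrable (fun t => f (c t) * fderiv ℝ h (c t) w) volume 0 1 := fun w c hc =>
    ((hcf.comp hc).mul ((hcp w).comp hc)).intervalIntegrable _ _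
  -- The two iterated integrals run along the hypotenuse in opposite directions.
  have hswap : ∫ a in (0 : ℝ)..1, f (a, 1 - a) * fderiv ℝ h (a, 1 - a) (1, 0) =
      ∫ t in (0 : ℝ)..1, f (1 - t, t) * fderiv ℝ h (1 - t, t) (1, 0) := by
    have := intervalIntegral.integral_comp_sub_left (a := 0) (b := 1)
      (fun t => f (1 - t, t) * fderiv ℝ h (1 - t, t) (1, 0)) 1
    simpa using this
  rw [integral_sub (hII _ (fun b => (1 - b, b)) (by fun_prop))
      (hII _ (fun b => (0, b)) (by fun_prop)),
    integral_sub (hII _ (fun a => (a, 1 - a)) (by fun_prop))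
      (hII _ (fun a => (a, 0)) (by fun_prop)), hswap]
  have e1 : lineIntegral (fun t => f (1 - t, t)) (fun t => h (1 - t, t)) =
      (∫ t in (0 : ℝ)..1, f (1 - t, t) * fderiv ℝ h (1 - t, t) (0, 1))
        - ∫ t in (0 : ℝ)..1, f (1 - t, t) * fderiv ℝ h (1 - t, t) (1, 0) := by
    rw [← integral_sub (hII _ (fun b => (1 - b, b)) (by fun_prop))
      (hII _ (fun b => (1 - b, b)) (by fun_prop))]
    simp only [lineIntegral, hdiag, mul_sub]
  have e2 : lineIntegral (fun t => f (0, t)) (fun t => h (0, t)) =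
      ∫ t in (0 : ℝ)..1, f (0, t) * fderiv ℝ h (0, t) (0, 1) := by
    simp only [lineIntegral, (hasDerivAt_snd hdh 0 _).deriv]
  have e3 : lineIntegral (fun t => f (t, 0)) (fun t => h (t, 0)) =
      ∫ t in (0 : ℝ)..1, f (t, 0) * fderiv ℝ h (t, 0) (1, 0) := by
    simp only [lineIntegral, (hasDerivAt_fst hdh _ 0).deriv]
  rw [e1, e2, e3]
  ring

/-- If `f` and `h` agree on the unit interval with smooth functions `f₀`, `h₀` up to additive
constants, then the line integrals differ by a boundary term. -/
theorem lineIntegral_add_const {f h f₀ h₀ : ℝ → ℝ} {c d : ℝ} (hh : ContDiff ℝ ∞ h)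
    (hf₀ : ContDiff ℝ ∞ f₀) (hh₀ : ContDiff ℝ ∞ h₀)
    (hf : ∀ t ∈ Set.Icc (0 : ℝ) 1, f t = f₀ t + c)
    (hd : ∀ t ∈ Set.Icc (0 : ℝ) 1, h t = h₀ t + d) :
    lineIntegral f h = lineIntegral f₀ h₀ + c * (h₀ 1 - h₀ 0) := by
  have hder : ∀ t ∈ Set.Icc (0 : ℝ) 1, deriv h t = deriv h₀ t := by
    intro t ht
    have hu := uniqueDiffOn_Icc (zero_lt_one (α := ℝ)) t ht
    rw [← (hh.differentiable (by simp) t).derivWithin hu,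
      ← (hh₀.differentiable (by simp) t).derivWithin hu, derivWithin_congr hd (hd t ht),
      derivWithin_add_const]
  have hc₀ : Continuous (deriv h₀) := hh₀.continuous_deriv (by simp)
  rw [← integral_deriv_eq_sub (fun t _ => hh₀.differentiable (by simp) t)
    (hc₀.intervalIntegrable _ _), ← intervalIntegral.integral_const_mul, lineIntegral,
    lineIntegral, ← integral_add (f := fun t => f₀ t * deriv h₀ t)
      (g := fun t => c * deriv h₀ t)
      ((hf₀.continuous.mul hc₀).intervalIntegrable _ _)
      ((continuous_const.mul hc₀).intervalIntegrable _ _)]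
  refine integral_congr fun t ht => ?_
  rw [Set.uIcc_of_le zero_le_one] at ht
  simp only [hf t ht, hder t ht]
  ring

end Green

namespace Multigraph

universe u v

variable {V : Type u} {E : Type v} (G : Multigraph V E)

/-! ### Change of coefficients -/

section BaseChange

variable {A B : Type*} [CommRing A] [CommRing B] (φ : A →+* B)

/-- The map `N_A → N_B` induced by a ring homomorphism `A → B`. -/
def mapNExt : G.NExt A →ₗ[ℤ] G.NExt B :=
  LinearMap.compRight ℤ φ.toAddMonoidHom.toIntLinearMap

@[simp]
theorem mapNExt_apply (f : G.NExt A) (γ : G.H₁) : G.mapNExt φ f γ = φ (f γ) := rfl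

@[simp]
theorem incl_apply (n : G.N) (γ : G.H₁) : G.incl A n γ = (n γ : A) := by
  simp [incl]

theorem mapNExt_incl (n : G.N) : G.mapNExt φ (G.incl A n) = G.incl B n := by
  ext γ; simp

theorem proj_single_apply (x : E → A) (e : E) (γ : G.H₁) :
    G.proj x (Finsupp.single e 1) γ = ((γ : E →₀ ℤ) e : A) * x e := by
  rw [← smul_incl_edgeClass, LinearMap.smul_apply, incl_apply, smul_eq_mul, mul_comm]
  rfl

theorem mapNExt_proj (x : E → A) (c : E →₀ ℤ) :
    G.mapNExt φ (G.proj x c) = G.proj (φ ∘ x) c := by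
  suffices h : G.mapNExt φ ∘ₗ G.proj x = G.proj (φ ∘ x) from LinearMap.congr_fun h c
  ext e γ
  simp [proj_single_apply]

variable [Finite E]

/-- The basis of `N_A` dual to the basis of cycles. -/
def basisNExt (A : Type*) [CommRing A] : Module.Basis (Fin G.genus) A (G.NExt A) :=
  Module.Basis.ofEquivFun (G.cycleBasis.constr A).symm

theorem basisNExt_coord (f : G.NExt A) (i : Fin G.genus) :
    (G.basisNExt A).coord i f = f (G.cycleBasis i) := by
  simp [basisNExt, Module.Basis.constr]

theorem basisNExt_eq_incl (i : Fin G.genus) :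
    G.basisNExt A i = G.incl A (G.cocycleBasis i) := by
  refine G.cycleBasis.ext fun j => ?_
  rw [← basisNExt_coord]
  simp [cocycleBasis, Finsupp.single_apply, eq_comm]

/-- The basis of `⋀³ N_A` obtained from the basis of `N_A`. -/
abbrev basisWedge (A : Type*) [CommRing A] :=
  (G.basisNExt A).exteriorPower 3

/-- Coordinates of a decomposable element are 3×3 minors. Identities in the exterior cube are later
checked by expanding them. -/
theorem basisWedge_repr_ιMulti (w : Fin 3 → G.NExt A)
    (s : Set.powersetCard (Fin G.genus) 3) :
    (G.basisWedge A).repr (exteriorPower.ιMulti A 3 w) s =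
      (Matrix.of fun i j =>
        w i (G.cycleBasis (Set.powersetCard.ofFinEmbEquiv.symm s j))).det := by
  rw [exteriorPower.basis_repr_apply, exteriorPower.ιMultiDual_apply_ιMulti]
  simp only [basisNExt_coord]

/-- The map `⋀³ N_A → ⋀³ N_B` induced by a ring homomorphism `A → B`. -/
def mapWedge : ⋀[A]^3 (G.NExt A) →ₗ[ℤ] ⋀[B]^3 (G.NExt B) :=
  AddMonoidHom.toIntLinearMap
    { toFun := fun w => ∑ s, φ ((G.basisWedge A).repr w s) • G.basisWedge B s
      map_zero' := by simp
      map_add' := by simp [add_smul, Finset.sum_add_distrib] }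

theorem repr_mapWedge (w : ⋀[A]^3 (G.NExt A)) (s : Set.powersetCard (Fin G.genus) 3) :
    (G.basisWedge B).repr (G.mapWedge φ w) s = φ ((G.basisWedge A).repr w s) := by
  classical
  change (G.basisWedge B).repr (∑ t, φ ((G.basisWedge A).repr w t) • G.basisWedge B t) s = _
  rw [Module.Basis.repr_sum_self]

/-- For evaluation at `ℓ`, this turns the vanishing of a specialized class into polynomial equations
in the lengths. -/
theorem mapWedge_eq_zero_iff (w : ⋀[A]^3 (G.NExt A)) :
    G.mapWedge φ w = 0 ↔ ∀ s, φ ((G.basisWedge A).repr w s) = 0 := by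
  simp only [← repr_mapWedge]
  rw [← (G.basisWedge B).repr.map_eq_zero_iff]
  exact Finsupp.ext_iff

/-- Both sides have minors as coordinates, and a ring homomorphism commutes with determinants. -/
theorem mapWedge_ιMulti (w : Fin 3 → G.NExt A) :
    G.mapWedge φ (exteriorPower.ιMulti A 3 w) =
      exteriorPower.ιMulti B 3 fun i => G.mapNExt φ (w i) := by
  refine (G.basisWedge B).repr.injective (Finsupp.ext fun s => ?_)
  rw [repr_mapWedge, basisWedge_repr_ιMulti, basisWedge_repr_ιMulti, RingHom.map_det]
  rfl

/-- A sum over the three-element subsets as a sum over increasing triples. -/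
theorem sum_powersetCard_three {M : Type*} [AddCommMonoid M] {m : ℕ}
    (f : (Fin 3 → Fin m) → M) :
    ∑ s : Set.powersetCard (Fin m) 3, f (Set.powersetCard.ofFinEmbEquiv.symm s) =
      ∑ I : Fin m × Fin m × Fin m with I.1 < I.2.1 ∧ I.2.1 < I.2.2,
        f ![I.1, I.2.1, I.2.2] := by
  rw [Equiv.sum_comp (Set.powersetCard.ofFinEmbEquiv (n := 3) (I := Fin m)).symm
    (fun g => f g)]
  refine Finset.sum_bij (fun g _ => (g 0, g 1, g 2)) ?_ ?_ ?_ ?_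
  · intro g _
    simp
  · intro g _ h _ hgh
    simp only [Prod.mk.injEq] at hgh
    ext i
    fin_cases i <;> simp [hgh]
  · rintro ⟨i, j, k⟩ h
    simp only [Finset.mem_filter, Finset.mem_univ, true_and] at h
    refine ⟨OrderEmbedding.ofStrictMono ![i, j, k] ?_, Finset.mem_univ _, rfl⟩
    rw [Fin.strictMono_iff_lt_succ]
    intro a
    fin_cases a
    · exact h.1
    · exact h.2
  · intro g _
    congr 1
    ext i
    fin_cases i <;> rfl

/-- Laplace expansion of each minor along the row of `n`, which is the shape in which `Θ_C` is
defined. -/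
theorem ιMulti_eq_sum (n p q : G.NExt A) :
    exteriorPower.ιMulti A 3 ![n, p, q] =
      ∑ I : Fin G.genus × Fin G.genus × Fin G.genus with I.1 < I.2.1 ∧ I.2.1 < I.2.2,
        (n (G.cycleBasis I.1) * (p (G.cycleBasis I.2.1) * q (G.cycleBasis I.2.2)
            - p (G.cycleBasis I.2.2) * q (G.cycleBasis I.2.1))
          - n (G.cycleBasis I.2.1) * (p (G.cycleBasis I.1) * q (G.cycleBasis I.2.2)
            - p (G.cycleBasis I.2.2) * q (G.cycleBasis I.1))
          + n (G.cycleBasis I.2.2) * (p (G.cycleBasis I.1) * q (G.cycleBasis I.2.1)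
            - p (G.cycleBasis I.2.1) * q (G.cycleBasis I.1))) •
          exteriorPower.ιMulti A 3 ![G.incl A (G.cocycleBasis I.1),
            G.incl A (G.cocycleBasis I.2.1), G.incl A (G.cocycleBasis I.2.2)] := by
  conv_lhs => rw [← (G.basisWedge A).sum_repr (exteriorPower.ιMulti A 3 ![n, p, q])]
  simp only [basisWedge_repr_ιMulti, exteriorPower.basis_apply, exteriorPower.ιMulti_family]
  rw [sum_powersetCard_three (fun g : Fin 3 → Fin G.genus =>
    (Matrix.of fun i j => (![n, p, q] : Fin 3 → G.NExt A) i (G.cycleBasis (g j))).det •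
      exteriorPower.ιMulti A 3 (G.basisNExt A ∘ g))]
  refine Finset.sum_congr rfl fun I _ => ?_
  congr 1
  · rw [Matrix.det_fin_three]
    simp only [Matrix.of_apply, Matrix.cons_val_zero, Matrix.cons_val_one, Matrix.cons_val]
    ring
  · congr 1
    ext i : 1
    fin_cases i <;> simp [basisNExt_eq_incl]

end BaseChange

variable (l : G.Length)

/-! ### Lifts of smooth simplices and their periods -/

section Lifts

theorem proj_apply_eq_sum [Fintype E] {A : Type*} [CommRing A] (x : E → A) (c : E →₀ ℤ)
    (γ : G.H₁) : G.proj x c γ = ∑ e, (c e : A) * ((γ : E →₀ ℤ) e : A) * x e := by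
  conv_lhs => rw [← Finsupp.univ_sum_single c]
  rw [map_sum, LinearMap.sum_apply]
  refine Finset.sum_congr rfl fun e _ => ?_
  rw [← mul_one (c e), ← smul_eq_mul, ← Finsupp.smul_single, map_smul, LinearMap.smul_apply,
    proj_single_apply]
  simp [mul_assoc]

section

variable {G l}

theorem mem_lattice_iff {c : G.NReal} :
    c ∈ G.lattice l.1 ↔ ∃ γ : G.H₁, G.projC l (γ : E →₀ ℤ) = c := Iff.rfl

/-- The point of `Δ²` with affine coordinates `p`. -/
abbrev trianglePoint (p : ℝ × ℝ) : Fin 3 → ℝ := ![1 - p.1 - p.2, p.1, p.2]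

theorem trianglePoint_mem {p : ℝ × ℝ} (hp : p ∈ triangle) :
    trianglePoint p ∈ stdSimplex ℝ (Fin 3) := by
  obtain ⟨h₁, h₂, h₃⟩ := hp
  refine ⟨fun i => ?_, by simp [Fin.sum_univ_three]; ring⟩
  fin_cases i
  · change 0 ≤ 1 - p.1 - p.2
    linarith
  · exact h₁
  · exact h₂

theorem contDiff_trianglePoint : ContDiff ℝ ∞ trianglePoint := by
  refine contDiff_pi.2 fun i => ?_
  fin_cases i
  · exact (contDiff_const.sub contDiff_fst).sub contDiff_snd
  · exact contDiff_fst
  · exact contDiff_snd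

/-- The path `g` in `N_ℝ` is a smooth lift of the smooth edge `s`. -/
structure IsEdgeLift (s : G.SmoothSimplex l 1) (g : ℝ → G.NReal) : Prop where
  smooth : ∀ γ, ContDiff ℝ ∞ fun t => g t γ
  lifts : ∀ x : stdSimplex ℝ (Fin 2), s.toFun x = QuotientAddGroup.mk (g (x.1 1))

/-- The initial point of a smooth edge, lifted to `N_ℝ`. -/
def edgeStart (s : G.SmoothSimplex l 1) : G.NReal := (s.toFun (stdSimplex.vertex 0)).out

/-- The terminal point of a smooth edge, lifted to `N_ℝ`. -/
def edgeEnd (s : G.SmoothSimplex l 1) : G.NReal := (s.toFun (stdSimplex.vertex 1)).out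

theorem isEdgeLift_of_lift {s : G.SmoothSimplex l 1} {f : (Fin 2 → ℝ) → G.NReal}
    (hf : G.IsSmooth f) (h : ∀ t, s.toFun t = QuotientAddGroup.mk (f t.1)) :
    IsEdgeLift s fun t => f ![1 - t, t] where
  smooth γ := by
    refine (hf γ).comp (contDiff_pi.2 fun i => ?_)
    fin_cases i
    · exact contDiff_const.sub contDiff_id
    · exact contDiff_id
  lifts x := by
    rw [h x]
    congr 2
    have hx := x.2.2
    rw [Fin.sum_univ_two] at hx
    ext i
    fin_cases i
    · change x.1 0 = 1 - x.1 1
      linarith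
    · rfl

theorem linearMap_fin_two {ι : Type*} [Fintype ι] [DecidableEq ι] (g : Fin 2 → ι)
    (t : Fin 2 → ℝ) (j : ι) : FunOnFinite.linearMap ℝ ℝ g t j =
      (if g 0 = j then t 0 else 0) + if g 1 = j then t 1 else 0 := by
  rw [FunOnFinite.linearMap_apply_apply, Finset.sum_filter, Fin.sum_univ_two]

/-- Condition `hi` says, in barycentric coordinates, that `c` parametrizes the face. The three
curves used below are those of Green's formula. -/
theorem isEdgeLift_face {s : G.SmoothSimplex l 2} {f : (Fin 3 → ℝ) → G.NReal}
    (hf : G.IsSmooth f) (h : ∀ t, s.toFun t = QuotientAddGroup.mk (f t.1)) (i : Fin 3)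
    {c : ℝ → ℝ × ℝ} (hc : ContDiff ℝ ∞ c)
    (hi : ∀ a b : ℝ, a + b = 1 → ∀ j, ((if i.succAbove 0 = j then a else 0) +
      if i.succAbove 1 = j then b else 0) = trianglePoint (c b) j) :
    IsEdgeLift (s.face i) fun t => f (trianglePoint (c t)) where
  smooth γ := ((hf γ).comp contDiff_trianglePoint).comp hc
  lifts x := by
    refine (h (stdSimplex.map i.succAbove x)).trans ?_
    congr 2
    ext j
    refine (linearMap_fin_two i.succAbove x.1 j).trans (hi _ _ ?_ j)
    exact (Fin.sum_univ_two _).symm.trans x.2.2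

theorem isEdgeLift_face_zero {s : G.SmoothSimplex l 2} {f : (Fin 3 → ℝ) → G.NReal}
    (hf : G.IsSmooth f) (h : ∀ t, s.toFun t = QuotientAddGroup.mk (f t.1)) :
    IsEdgeLift (s.face 0) fun t => f (trianglePoint (1 - t, t)) := by
  refine isEdgeLift_face hf h 0 ((contDiff_const.sub contDiff_id).prodMk contDiff_id) ?_
  intro a b hab j
  obtain rfl : a = 1 - b := by linarith
  fin_cases j <;> simp [Fin.succAbove, Fin.ext_iff]

theorem isEdgeLift_face_one {s : G.SmoothSimplex l 2} {f : (Fin 3 → ℝ) → G.NReal}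
    (hf : G.IsSmooth f) (h : ∀ t, s.toFun t = QuotientAddGroup.mk (f t.1)) :
    IsEdgeLift (s.face 1) fun t => f (trianglePoint (0, t)) := by
  refine isEdgeLift_face hf h 1 (contDiff_const.prodMk contDiff_id) ?_
  intro a b hab j
  obtain rfl : a = 1 - b := by linarith
  fin_cases j <;> simp [Fin.succAbove, Fin.ext_iff]

theorem isEdgeLift_face_two {s : G.SmoothSimplex l 2} {f : (Fin 3 → ℝ) → G.NReal}
    (hf : G.IsSmooth f) (h : ∀ t, s.toFun t = QuotientAddGroup.mk (f t.1)) :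
    IsEdgeLift (s.face 2) fun t => f (trianglePoint (t, 0)) := by
  refine isEdgeLift_face hf h 2 (contDiff_id.prodMk contDiff_const) ?_
  intro a b hab j
  obtain rfl : a = 1 - b := by linarith
  fin_cases j <;> simp [Fin.succAbove, Fin.ext_iff]

theorem face_vertex (s : G.SmoothSimplex l 2) (i : Fin 3) (j : Fin 2) :
    (s.face i).toFun (stdSimplex.vertex j) = s.toFun (stdSimplex.vertex (i.succAbove j)) := by
  change s.toFun (stdSimplex.map i.succAbove _) = _
  rw [stdSimplex.map_vertex]

/-- The chosen lift of an endpoint depends only on the point of the Jacobian, so edges meeting at a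
vertex share it. -/
theorem edgeStart_face_zero (s : G.SmoothSimplex l 2) :
    edgeStart (s.face 0) = edgeEnd (s.face 2) := by
  rw [edgeStart, edgeEnd, face_vertex, face_vertex]; rfl

theorem edgeStart_face_one (s : G.SmoothSimplex l 2) :
    edgeStart (s.face 1) = edgeStart (s.face 2) := by
  rw [edgeStart, edgeStart, face_vertex, face_vertex]; rfl

theorem edgeEnd_face_one (s : G.SmoothSimplex l 2) :
    edgeEnd (s.face 1) = edgeEnd (s.face 0) := by
  rw [edgeEnd, edgeEnd, face_vertex, face_vertex]; rfl

theorem exists_edgeLift (s : G.SmoothSimplex l 1) :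
    ∃ g, IsEdgeLift s g ∧ g 0 = edgeStart s := by
  obtain ⟨f, hf, h⟩ := s.smooth
  have hg := isEdgeLift_of_lift hf h
  set g := fun t : ℝ => f ![1 - t, t]
  have h0 : (QuotientAddGroup.mk (g 0) : G.Jac l) = QuotientAddGroup.mk (edgeStart s) := by
    have := hg.lifts (stdSimplex.vertex 0)
    rw [edgeStart, QuotientAddGroup.out_eq', this]
    simp
  refine ⟨fun t => g t + (-g 0 + edgeStart s),
    ⟨fun γ => (hg.smooth γ).add contDiff_const, fun x => ?_⟩, by simp⟩
  rw [hg.lifts x, QuotientAddGroup.eq]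
  simpa using QuotientAddGroup.eq.1 h0

/-- The lift of a smooth edge which starts at the chosen lift of its initial point. -/
def edgeLift (s : G.SmoothSimplex l 1) : ℝ → G.NReal := (exists_edgeLift s).choose

theorem isEdgeLift_edgeLift (s : G.SmoothSimplex l 1) : IsEdgeLift s (edgeLift s) :=
  (exists_edgeLift s).choose_spec.1

theorem edgeLift_zero (s : G.SmoothSimplex l 1) : edgeLift s 0 = edgeStart s :=
  (exists_edgeLift s).choose_spec.2

theorem exists_edgePeriod (s : G.SmoothSimplex l 1) :
    ∃ γ : G.H₁, G.projC l (γ : E →₀ ℤ) = edgeLift s 1 - edgeEnd s := by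
  rw [← mem_lattice_iff, ← QuotientAddGroup.eq_zero_iff, QuotientAddGroup.mk_sub, sub_eq_zero,
    edgeEnd, QuotientAddGroup.out_eq', (isEdgeLift_edgeLift s).lifts]
  simp

/-- The cycle that measures by how much the lift of a smooth edge misses the chosen lift of its
terminal point. -/
def edgePeriod (s : G.SmoothSimplex l 1) : G.H₁ := (exists_edgePeriod s).choose

theorem edgeLift_one (s : G.SmoothSimplex l 1) :
    edgeLift s 1 = edgeEnd s + G.projC l (edgePeriod s : E →₀ ℤ) := by
  rw [edgePeriod, (exists_edgePeriod s).choose_spec, add_sub_cancel]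

/-- With this normalization the lifts of faces 1 and 2 start at the chosen points; only the lift of
face 0 is displaced, by the period of face 2. -/
theorem exists_normalized_lift (s : G.SmoothSimplex l 2) :
    ∃ f, G.IsSmooth f ∧ (∀ t, s.toFun t = QuotientAddGroup.mk (f t.1)) ∧
      f (trianglePoint (0, 0)) = edgeStart (s.face 2) := by
  obtain ⟨f, hf, h⟩ := s.smooth
  have h0 : (QuotientAddGroup.mk (f (trianglePoint (0, 0))) : G.Jac l) =
      QuotientAddGroup.mk (edgeStart (s.face 2)) := by
    rw [edgeStart, QuotientAddGroup.out_eq', (isEdgeLift_face_two hf h).lifts]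
    simp
  refine ⟨fun t => f t + (-f (trianglePoint (0, 0)) + edgeStart (s.face 2)),
    fun γ => (hf γ).add contDiff_const, fun t => ?_, by simp⟩
  rw [h t, QuotientAddGroup.eq]
  simpa using QuotientAddGroup.eq.1 h0

end

variable [Finite E]

/-- The length pairing is positive definite, so that `H₁` embeds in `N_ℝ`. -/
theorem projC_injective_on_H₁ {γ γ' : G.H₁}
    (h : G.projC l (γ : E →₀ ℤ) = G.projC l (γ' : E →₀ ℤ)) : γ = γ' := by
  have := Fintype.ofFinite E
  have h0 : G.projC l ((γ - γ' : G.H₁) : E →₀ ℤ) (γ - γ') = 0 := by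
    rw [Submodule.coe_sub, (G.projC l).map_sub, h, sub_self, LinearMap.zero_apply]
  rw [projC, proj_apply_eq_sum, Finset.sum_eq_zero_iff_of_nonneg
    (fun e _ => mul_nonneg (mul_self_nonneg _) (l.2 e).le)] at h0
  rw [← sub_eq_zero]
  refine Subtype.ext (Finsupp.ext fun e => ?_)
  have he := h0 e (Finset.mem_univ e)
  simp only [mul_eq_zero, (l.2 e).ne', or_self, or_false, Int.cast_eq_zero] at he
  exact he

theorem countable_lattice : (G.lattice l.1 : Set G.NReal).Countable := by
  have : Countable G.H₁ := inferInstanceAs (Countable (LinearMap.ker G.boundary₁))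
  exact Set.countable_range (G.proj l.1 ∘ₗ G.H₁.subtype)

variable {G l}

/-- Two continuous lifts to `N_ℝ` of the same map from a connected space differ by an element of
the lattice. -/
theorem lift_eq_add_const {X : Type*} [TopologicalSpace X] {S : Set X} (hS : IsPreconnected S)
    {f g : X → G.NReal} (hf : ∀ γ, Continuous fun x => f x γ)
    (hg : ∀ γ, Continuous fun x => g x γ)
    (h : ∀ x ∈ S, (QuotientAddGroup.mk (f x) : G.Jac l) = QuotientAddGroup.mk (g x))
    {x₀ x : X} (hx₀ : x₀ ∈ S) (hx : x ∈ S) : g x = f x + (g x₀ - f x₀) := by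
  ext γ
  have hc : Continuous fun x => g x γ - f x γ := (hg γ).sub (hf γ)
  have hpre := hS.image _ hc.continuousOn
  have hcount : ((fun c : G.NReal => c γ) '' (G.lattice l.1 : Set G.NReal)).Countable :=
    (G.countable_lattice l).image _
  have hsub : (fun x => g x γ - f x γ) '' S ⊆
      (fun c : G.NReal => c γ) '' (G.lattice l.1 : Set G.NReal) := by
    rintro _ ⟨y, hy, rfl⟩
    exact ⟨-f y + g y, QuotientAddGroup.eq.1 (h y hy), by simp; ring⟩
  -- The coordinate of the difference has a connected image inside a countable set, hence is
  -- constant.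
  have := hcount.isTotallyDisconnected _ hsub hpre (Set.mem_image_of_mem _ hx)
    (Set.mem_image_of_mem _ hx₀)
  simp only [LinearMap.add_apply, LinearMap.sub_apply]
  linarith

/-- The integrals `∫_σ dz_i ∧ dz_j` can be computed with any smooth lift. -/
theorem integral₂_eq (s : G.SmoothSimplex l 2) {f : (Fin 3 → ℝ) → G.NReal} (hf : G.IsSmooth f)
    (h : ∀ t, s.toFun t = QuotientAddGroup.mk (f t.1)) (i j : Fin G.genus) :
    G.integral₂ l s i j = ∫ p in triangle,
      (fderiv ℝ (fun p => f (trianglePoint p) (G.cycleBasis i)) p (1, 0) *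
          fderiv ℝ (fun p => f (trianglePoint p) (G.cycleBasis j)) p (0, 1)
        - fderiv ℝ (fun p => f (trianglePoint p) (G.cycleBasis i)) p (0, 1) *
          fderiv ℝ (fun p => f (trianglePoint p) (G.cycleBasis j)) p (1, 0)) := by
  obtain ⟨hs, hs'⟩ : G.IsSmooth s.lift ∧ ∀ t, s.toFun t = QuotientAddGroup.mk (s.lift t.1) :=
    s.smooth.choose_spec
  have hd : ∀ {f : (Fin 3 → ℝ) → G.NReal}, G.IsSmooth f → ∀ γ,
      Differentiable ℝ fun p => f (trianglePoint p) γ := fun hf γ =>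
    ((hf γ).comp contDiff_trianglePoint).differentiable (by simp)
  -- The lifts differ by a constant on the triangle only, so derivatives are compared within it.
  have hfd : ∀ γ, ∀ p ∈ triangle, fderiv ℝ (fun p => s.lift (trianglePoint p) γ) p =
      fderiv ℝ (fun p => f (trianglePoint p) γ) p := by
    intro γ p hp
    have hu := uniqueDiffOn_triangle p hp
    have heq : ∀ p' ∈ triangle, s.lift (trianglePoint p') γ =
        f (trianglePoint p') γ + (s.lift (trianglePoint p) γ - f (trianglePoint p) γ) := by
      intro p' hp'
      have := lift_eq_add_const (convex_stdSimplex ℝ (Fin 3)).isPreconnected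
        (fun γ => (hf γ).continuous) (fun γ => (hs γ).continuous)
        (fun t ht => (h ⟨t, ht⟩).symm.trans (hs' ⟨t, ht⟩)) (trianglePoint_mem hp)
        (trianglePoint_mem hp')
      exact LinearMap.congr_fun this γ
    rw [← (hd hf γ p).fderivWithin hu, ← (hd hs γ p).fderivWithin hu]
    refine (fderivWithin_congr heq (heq p hp)).trans ?_
    rw [fderivWithin_add_const]
  refine MeasureTheory.setIntegral_congr_fun isCompact_triangle.isClosed.measurableSet
    fun p hp => ?_
  change fderiv ℝ (fun p => s.lift (trianglePoint p) (G.cycleBasis i)) p (1, 0) *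
      fderiv ℝ (fun p => s.lift (trianglePoint p) (G.cycleBasis j)) p (0, 1)
    - fderiv ℝ (fun p => s.lift (trianglePoint p) (G.cycleBasis i)) p (0, 1) *
      fderiv ℝ (fun p => s.lift (trianglePoint p) (G.cycleBasis j)) p (1, 0) = _
  rw [hfd _ p hp, hfd _ p hp]

theorem IsEdgeLift.eq_add_const {s : G.SmoothSimplex l 1} {g g' : ℝ → G.NReal}
    (hg : IsEdgeLift s g) (hg' : IsEdgeLift s g') {t : ℝ} (ht : t ∈ Set.Icc (0 : ℝ) 1) :
    g' t = g t + (g' 0 - g 0) := by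
  refine lift_eq_add_const (l := l) isPreconnected_Icc (fun γ => (hg.smooth γ).continuous)
    (fun γ => (hg'.smooth γ).continuous) (fun t ht => ?_) (Set.left_mem_Icc.2 zero_le_one) ht
  let x : stdSimplex ℝ (Fin 2) := ⟨![1 - t, t], fun i => by
    fin_cases i
    · exact sub_nonneg.2 ht.2
    · exact ht.1, by simp⟩
  exact (hg.lifts x).symm.trans (hg'.lifts x)

theorem IsEdgeLift.lineIntegral_eq {s : G.SmoothSimplex l 1} {g : ℝ → G.NReal}
    (hg : IsEdgeLift s g) (γ γ' : G.H₁) :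
    lineIntegral (fun t => g t γ) (fun t => g t γ') =
      lineIntegral (fun t => edgeLift s t γ) (fun t => edgeLift s t γ')
        + (g 0 - edgeStart s) γ *
          (edgeEnd s + G.projC l (edgePeriod s : E →₀ ℤ) - edgeStart s) γ' := by
  have hs := isEdgeLift_edgeLift s
  rw [lineIntegral_add_const (hg.smooth γ') (hs.smooth γ) (hs.smooth γ')
    (fun t ht => by rw [hs.eq_add_const hg ht]; rfl)
    (fun t ht => by rw [hs.eq_add_const hg ht]; rfl), edgeLift_zero, edgeLift_one]
  rfl

theorem IsEdgeLift.apply_one {s : G.SmoothSimplex l 1} {g : ℝ → G.NReal}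
    (hg : IsEdgeLift s g) :
    g 1 = edgeEnd s + G.projC l (edgePeriod s : E →₀ ℤ) + (g 0 - edgeStart s) := by
  rw [(isEdgeLift_edgeLift s).eq_add_const hg (Set.right_mem_Icc.2 zero_le_one), edgeLift_zero,
    edgeLift_one]

/-- The function on smooth edges whose coboundary accounts for the difference between the integral
of `dz_i ∧ dz_j` and the cup product of the edge periods. -/
def edgeCochain (γ γ' : G.H₁) (s : G.SmoothSimplex l 1) : ℝ :=
  lineIntegral (fun t => edgeLift s t γ) (fun t => edgeLift s t γ')
    - G.projC l (edgePeriod s : E →₀ ℤ) γ * edgeEnd s γ'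

/-- The cocycle condition: the boundary of a lifted triangle closes up in `N_ℝ`, and `H₁` embeds
there. -/
theorem edgePeriod_face_one (s : G.SmoothSimplex l 2) :
    edgePeriod (s.face 1) = edgePeriod (s.face 0) + edgePeriod (s.face 2) := by
  obtain ⟨f, hf, h, h0⟩ := exists_normalized_lift s
  have e0 := (isEdgeLift_face_zero hf h).apply_one
  have e1 := (isEdgeLift_face_one hf h).apply_one
  have e2 := (isEdgeLift_face_two hf h).apply_one
  simp only [sub_self, sub_zero] at e0 e1 e2
  rw [h0, edgeStart_face_one, edgeEnd_face_one, sub_self, add_zero] at e1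
  rw [h0, sub_self, add_zero] at e2
  rw [e1, e2, edgeStart_face_zero] at e0
  apply G.projC_injective_on_H₁ l
  rw [Submodule.coe_add, map_add]
  simpa [add_assoc] using e0

/-- Up to a coboundary, the integral of `dz_i ∧ dz_j` is the cup product of the edge periods. -/
theorem integral₂_eq_cup (s : G.SmoothSimplex l 2) (i j : Fin G.genus) :
    G.integral₂ l s i j =
      edgeCochain (G.cycleBasis i) (G.cycleBasis j) (s.face 0)
        - edgeCochain (G.cycleBasis i) (G.cycleBasis j) (s.face 1)
        + edgeCochain (G.cycleBasis i) (G.cycleBasis j) (s.face 2)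
        + G.projC l (edgePeriod (s.face 2) : E →₀ ℤ) (G.cycleBasis i) *
          G.projC l (edgePeriod (s.face 0) : E →₀ ℤ) (G.cycleBasis j) := by
  obtain ⟨f, hf, h, h0⟩ := exists_normalized_lift s
  have e2 := (isEdgeLift_face_two hf h).apply_one
  simp only [h0, sub_self, add_zero] at e2
  rw [integral₂_eq s hf h, setIntegral_triangle_wedge
      (f := fun p => f (trianglePoint p) (G.cycleBasis i))
      (h := fun p => f (trianglePoint p) (G.cycleBasis j))
      ((hf _).comp contDiff_trianglePoint) ((hf _).comp contDiff_trianglePoint),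
    (isEdgeLift_face_zero hf h).lineIntegral_eq,
    (isEdgeLift_face_one hf h).lineIntegral_eq, (isEdgeLift_face_two hf h).lineIntegral_eq]
  -- The displacement of face 0 contributes the period of face 2 times the total increment of face
  -- 0. The part involving chosen endpoints is absorbed by the second term of `edgeCochain`; the
  -- product of periods is left.
  simp only [sub_zero, h0, e2, edgeStart_face_one, edgeStart_face_zero, edgeCochain,
    edgePeriod_face_one, edgeEnd_face_one, Submodule.coe_add, map_add, LinearMap.add_apply,
    LinearMap.sub_apply]
  ring

end Lifts

/-! ### Chains with coefficients -/

theorem tensor_finsupp_hom_ext {N X M : Type*} [AddCommGroup N] [AddCommGroup M]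
    {f g : N ⊗[ℤ] (X →₀ ℤ) →ₗ[ℤ] M}
    (h : ∀ n x, f (n ⊗ₜ Finsupp.single x 1) = g (n ⊗ₜ Finsupp.single x 1)) : f = g := by
  refine LinearMap.ext fun t => ?_
  induction t using TensorProduct.induction_on with
  | zero => exact f.map_zero.trans g.map_zero.symm
  | add x y hx hy => exact (f.map_add x y).trans ((congrArg₂ _ hx hy).trans (g.map_add x y).symm)
  | tmul n c =>
    induction c using Finsupp.induction_linear with
    | zero =>
      rw [TensorProduct.tmul_zero]
      exact f.map_zero.trans g.map_zero.symm
    | add x y hx hy =>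
      rw [TensorProduct.tmul_add]
      exact (f.map_add _ _).trans ((congrArg₂ _ hx hy).trans (g.map_add _ _).symm)
    | single x m =>
      have : (Finsupp.single x m : X →₀ ℤ) = m • Finsupp.single x 1 := by simp
      rw [this, TensorProduct.tmul_smul]
      exact (f.map_smul m _).trans ((congrArg (m • ·) (h n x)).trans (g.map_smul m _).symm)

section Boundary

variable {q : ℕ}

theorem stBoundary_tmul (n : G.N) (c : G.SChain l (q + 1)) :
    G.stBoundary l q (n ⊗ₜ c) = n ⊗ₜ G.sBoundary l q c := rfl

theorem tBoundary_tmul (n : G.N) (c : G.Chain (q + 1)) :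
    G.tBoundary q (n ⊗ₜ c) = n ⊗ₜ G.boundary q c := rfl

theorem sBoundary_single (s : G.SmoothSimplex l (q + 1)) :
    G.sBoundary l q (Finsupp.single s 1) =
      ∑ i : Fin (q + 2), (-1 : ℤ) ^ (i : ℕ) • Finsupp.single (s.face i) 1 := by
  rw [sBoundary, LinearMap.sum_apply]
  refine Finset.sum_congr rfl fun i _ => ?_
  rw [LinearMap.smul_apply, Finsupp.lmapDomain_apply, Finsupp.mapDomain_single]

theorem boundary_single (s : G.Simplex (q + 1)) :
    G.boundary q (Finsupp.single s 1) =
      ∑ i : Fin (q + 2), (-1 : ℤ) ^ (i : ℕ) • Finsupp.single (G.face i s) 1 := by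
  rw [boundary, LinearMap.sum_apply]
  refine Finset.sum_congr rfl fun i _ => ?_
  rw [LinearMap.smul_apply, Finsupp.lmapDomain_apply, Finsupp.mapDomain_single]

theorem sNegPush_tmul_single (n : G.N) (s : G.SmoothSimplex l q) :
    G.sNegPush l q (n ⊗ₜ Finsupp.single s 1) = -(n ⊗ₜ Finsupp.single s.neg 1) := by
  refine (TensorProduct.map_tmul _ _ _ _).trans ?_
  rw [Finsupp.lmapDomain_apply, Finsupp.mapDomain_single]
  rfl

theorem negPush_tmul_single (n : G.N) (s : G.Simplex q) :
    G.negPush q (n ⊗ₜ Finsupp.single s 1) =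
      -(n ⊗ₜ Finsupp.single (G.negSimplex s) 1) := by
  refine (TensorProduct.map_tmul _ _ _ _).trans ?_
  rw [Finsupp.lmapDomain_apply, Finsupp.mapDomain_single]
  rfl

theorem theta_tmul_simplex (n : G.N) (a : Fin 3 → G.NR) :
    G.theta (n ⊗ₜ Finsupp.single (G.simplex a) 1) =
      exteriorPower.ιMulti G.R 3 ![G.incl G.R n, a 1 - a 0, a 2 - a 0] := by
  refine (TensorProduct.lift.tmul _ _).trans ?_
  rw [LinearMap.flip_apply, Finsupp.linearCombination_single, one_smul]
  rfl

end Boundary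

/-! ### Affine simplices -/

section Affine

variable {G} {q : ℕ}

theorem affine_eq_of_translate {a b : Fin (q + 1) → G.NReal} {c : G.NReal}
    (hc : c ∈ G.lattice l.1) (h : ∀ i, b i = a i + c) :
    SmoothSimplex.affine l a = SmoothSimplex.affine l b := by
  ext t
  change (QuotientAddGroup.mk _ : G.Jac l) = QuotientAddGroup.mk _
  rw [QuotientAddGroup.eq]
  have : ∑ i, t.1 i • b i = ∑ i, t.1 i • a i + c := by
    simp only [h, smul_add, Finset.sum_add_distrib, ← Finset.sum_smul]
    rw [t.2.2, one_smul]
  rw [this, neg_add_cancel_left]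
  exact hc

theorem face_affine (a : Fin (q + 2) → G.NReal) (i : Fin (q + 2)) :
    (SmoothSimplex.affine l a).face i = SmoothSimplex.affine l (a ∘ i.succAbove) := by
  ext t
  change (QuotientAddGroup.mk (∑ k, FunOnFinite.linearMap ℝ ℝ i.succAbove t.1 k • a k) :
    G.Jac l) = QuotientAddGroup.mk (∑ j, t.1 j • a (i.succAbove j))
  congr 1
  simp only [FunOnFinite.linearMap_apply_apply, Finset.sum_smul]
  rw [← Finset.sum_fiberwise Finset.univ i.succAbove]
  refine Finset.sum_congr rfl fun k _ => Finset.sum_congr rfl fun j hj => ?_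
  rw [(Finset.mem_filter.1 hj).2]

theorem neg_affine (a : Fin (q + 1) → G.NReal) :
    (SmoothSimplex.affine l a).neg = SmoothSimplex.affine l (-a) := by
  ext t
  change (-QuotientAddGroup.mk (∑ i, t.1 i • a i) : G.Jac l) =
    QuotientAddGroup.mk (∑ i, t.1 i • -a i)
  rw [← QuotientAddGroup.mk_neg]
  simp

variable [Finite E]

/-- The integrand is constant and the triangle has area `1/2`, which the factor 2 in `Θ_C`
compensates. -/
theorem integral₂_affine (a : Fin 3 → G.NReal) (i j : Fin G.genus) :
    G.integral₂ l (SmoothSimplex.affine l a) i j =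
      2⁻¹ * ((a 1 - a 0) (G.cycleBasis i) * (a 2 - a 0) (G.cycleBasis j)
        - (a 2 - a 0) (G.cycleBasis i) * (a 1 - a 0) (G.cycleBasis j)) := by
  have hs : G.IsSmooth fun t : Fin 3 → ℝ => ∑ i, t i • a i := fun γ => by
    simp only [LinearMap.sum_apply, LinearMap.smul_apply, smul_eq_mul]
    fun_prop
  rw [integral₂_eq _ hs (fun _ => rfl)]
  have hfd : ∀ γ p, fderiv ℝ (fun p => (∑ i, trianglePoint p i • a i) γ) p =
      (a 1 - a 0) γ • ContinuousLinearMap.fst ℝ ℝ ℝ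
        + (a 2 - a 0) γ • ContinuousLinearMap.snd ℝ ℝ ℝ := by
    intro γ p
    have : (fun p => (∑ i, trianglePoint p i • a i) γ) = fun p => a 0 γ +
        ((a 1 - a 0) γ • ContinuousLinearMap.fst ℝ ℝ ℝ
          + (a 2 - a 0) γ • ContinuousLinearMap.snd ℝ ℝ ℝ) p := by
      ext p
      simp [Fin.sum_univ_three]
      ring
    rw [this, fderiv_const_add, ContinuousLinearMap.fderiv]
  simp only [hfd]
  rw [setIntegral_triangle continuous_const]
  simp only [intervalIntegral.integral_const, smul_eq_mul, intervalIntegral.integral_mul_const,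
    sub_zero]
  have h1 : ∫ a in (0 : ℝ)..1, (1 - a) = 2⁻¹ := by
    rw [intervalIntegral.integral_sub (by simp) (by simp)]
    norm_num
  rw [h1]
  simp

theorem sTheta_tmul_single (n : G.N) (s : G.SmoothSimplex l 2) :
    G.sTheta l (n ⊗ₜ Finsupp.single s 1) = G.sThetaSimplex l s n := by
  refine (TensorProduct.lift.tmul _ _).trans ?_
  rw [LinearMap.flip_apply, Finsupp.linearCombination_single, one_smul]

theorem sThetaSimplex_affine (a : Fin 3 → G.NReal) (n : G.N) :
    G.sThetaSimplex l (SmoothSimplex.affine l a) n =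
      exteriorPower.ιMulti ℝ 3 ![G.incl ℝ n, a 1 - a 0, a 2 - a 0] := by
  rw [ιMulti_eq_sum]
  refine Eq.trans (Finset.smul_sum (M := ℝ) (N := G.WedgeReal)) ?_
  refine Finset.sum_congr rfl fun I _ => ?_
  rw [smul_smul, wedgeBasis]
  congr 1
  simp only [integral₂_affine, incl_apply]
  ring

end Affine

/-! ### Specialization of the universal chains -/

section Specialization

/-- Evaluation of the universal lengths at `l`. -/
abbrev evalLength : G.R →+* ℝ := (MvPolynomial.aeval l.1 : G.R →ₐ[ℤ] ℝ).toRingHom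

theorem mapNExt_projU (c : E →₀ ℤ) :
    G.mapNExt (G.evalLength l) (G.projU c) = G.projC l c := by
  rw [mapNExt_proj]
  congr 2
  ext e
  simp

/-- The affine simplex of the Jacobian of a curve obtained from a simplex of the universal
Jacobian. -/
def specializeSimplex (q : ℕ) : G.Simplex q → G.SmoothSimplex l q :=
  Quotient.lift (s := G.simplexSetoid q)
    (fun a => SmoothSimplex.affine l fun i => G.mapNExt (G.evalLength l) (a i)) (by
      rintro a b ⟨c, ⟨γ, rfl⟩, h⟩
      refine affine_eq_of_translate l (mem_lattice_iff.2 ⟨γ, rfl⟩) fun i => ?_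
      rw [h i, map_add, ← mapNExt_projU]
      rfl)

theorem specializeSimplex_simplex {q : ℕ} (a : Fin (q + 1) → G.NR) :
    G.specializeSimplex l q (G.simplex a) =
      SmoothSimplex.affine l fun i => G.mapNExt (G.evalLength l) (a i) := rfl

theorem specializeSimplex_face {q : ℕ} (i : Fin (q + 2)) (s : G.Simplex (q + 1)) :
    G.specializeSimplex l q (G.face i s) = (G.specializeSimplex l (q + 1) s).face i := by
  induction s using Quotient.inductionOn with
  | h a =>
    exact (face_affine l (fun i => G.mapNExt (G.evalLength l) (a i)) i).symm

theorem specializeSimplex_neg {q : ℕ} (s : G.Simplex q) :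
    G.specializeSimplex l q (G.negSimplex s) = (G.specializeSimplex l q s).neg := by
  induction s using Quotient.inductionOn with
  | h a =>
    refine Eq.trans ?_ (neg_affine l _).symm
    change SmoothSimplex.affine l _ = _
    congr 1
    ext i : 1
    exact map_neg _ _

/-- Specialization of the universal chains to the chains of a curve. -/
def specialize (q : ℕ) : G.TChain q →ₗ[ℤ] G.STChain l q :=
  LinearMap.lTensor G.N (Finsupp.lmapDomain ℤ ℤ (G.specializeSimplex l q))

theorem specialize_tmul_single {q : ℕ} (n : G.N) (s : G.Simplex q) :
    G.specialize l q (n ⊗ₜ Finsupp.single s 1) =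
      n ⊗ₜ Finsupp.single (G.specializeSimplex l q s) 1 := by
  refine (LinearMap.lTensor_tmul _ _ _ _).trans ?_
  rw [Finsupp.lmapDomain_apply, Finsupp.mapDomain_single]

theorem stBoundary_specialize (q : ℕ) (c : G.TChain (q + 1)) :
    G.stBoundary l q (G.specialize l (q + 1) c) = G.specialize l q (G.tBoundary q c) := by
  suffices h : G.stBoundary l q ∘ₗ G.specialize l (q + 1) = G.specialize l q ∘ₗ G.tBoundary q from
    LinearMap.congr_fun h c
  refine tensor_finsupp_hom_ext fun n s => ?_
  rw [LinearMap.comp_apply, LinearMap.comp_apply, specialize_tmul_single, stBoundary_tmul,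
    tBoundary_tmul, sBoundary_single, boundary_single, TensorProduct.tmul_sum,
    TensorProduct.tmul_sum, map_sum]
  refine Finset.sum_congr rfl fun i _ => ?_
  rw [TensorProduct.tmul_smul, TensorProduct.tmul_smul, map_smul, specialize_tmul_single,
    specializeSimplex_face]

theorem sNegPush_specialize (q : ℕ) (c : G.TChain q) :
    G.sNegPush l q (G.specialize l q c) = G.specialize l q (G.negPush q c) := by
  suffices h : G.sNegPush l q ∘ₗ G.specialize l q = G.specialize l q ∘ₗ G.negPush q from
    LinearMap.congr_fun h c
  refine tensor_finsupp_hom_ext fun n s => ?_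
  rw [LinearMap.comp_apply, LinearMap.comp_apply, specialize_tmul_single, sNegPush_tmul_single,
    negPush_tmul_single, map_neg, specialize_tmul_single, specializeSimplex_neg]

theorem specialize_ceresaCycle [Fintype E] (a : V) :
    G.specialize l 1 (G.ceresaCycle a) = G.tropicalCeresaCycle l (CurvePoint.vertex a) := by
  have h : ∀ e, G.specialize l 1 (G.abelJacobiEdge a e) =
      G.sAbelJacobiEdge l (CurvePoint.vertex a) e := by
    intro e
    rw [abelJacobiEdge, specialize_tmul_single, specializeSimplex_simplex, sAbelJacobiEdge]
    congr 3
    ext i : 1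
    fin_cases i
    · refine (G.mapNExt_projU l _).trans ?_
      simp [abelJacobiLift, CurvePoint.offset, CurvePoint.root]
    · refine (G.mapNExt_projU l _).trans ?_
      simp [abelJacobiLift, CurvePoint.offset, CurvePoint.root]
  simp only [ceresaCycle, tropicalCeresaCycle, map_sub, ← sNegPush_specialize, map_sum, h]

variable [Finite E]

/-- On affine simplices `Θ_C` is given by the same wedge as `Θ`, and wedges specialize entry by
entry. -/
theorem sTheta_specialize (c : G.TChain 2) :
    G.sTheta l (G.specialize l 2 c) = G.mapWedge (G.evalLength l) (G.theta c) := by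
  suffices h : G.sTheta l ∘ₗ G.specialize l 2 = G.mapWedge (G.evalLength l) ∘ₗ G.theta from
    LinearMap.congr_fun h c
  refine tensor_finsupp_hom_ext fun n s => ?_
  rw [LinearMap.comp_apply, LinearMap.comp_apply, specialize_tmul_single, sTheta_tmul_single]
  induction s using Quotient.inductionOn with
  | h a =>
    refine (sThetaSimplex_affine l _ n).trans ?_
    refine Eq.trans ?_ (congrArg _ (G.theta_tmul_simplex n a).symm)
    rw [mapWedge_ιMulti]
    congr 1
    ext i : 1
    fin_cases i
    · exact (G.mapNExt_incl _ n).symm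
    · exact (map_sub _ _ _).symm
    · exact (map_sub _ _ _).symm

theorem mapWedge_mem_tropicalPeriods {w : G.WedgeR} (hw : w ∈ G.periods) :
    G.mapWedge (G.evalLength l) w ∈ G.tropicalPeriods l := by
  obtain ⟨c, hc, rfl⟩ := hw
  refine ⟨G.specialize l 2 c, ?_, G.sTheta_specialize l c⟩
  change G.stBoundary l 1 _ = 0
  rw [stBoundary_specialize, show G.tBoundary 1 c = 0 from hc, map_zero]

end Specialization

/-! ### The tropical periods are the specializations of the universal ones -/

section Periods

theorem face_simplex {q : ℕ} (i : Fin (q + 2)) (a : Fin (q + 2) → G.NR) :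
    G.face i (G.simplex a) = G.simplex (a ∘ i.succAbove) := rfl

theorem simplex_eq_of_translate {q : ℕ} {a b : Fin (q + 1) → G.NR} {c : G.NR}
    (hc : c ∈ G.latticeU) (h : ∀ i, b i = a i + c) : G.simplex a = G.simplex b :=
  Quotient.sound ⟨c, hc, h⟩

/-- The sum of a symmetric family that vanishes on the diagonal. -/
theorem sum_sum_eq_two_smul_sum_lt {ι M : Type*} [Fintype ι] [LinearOrder ι] [AddCommGroup M]
    {T : ι → ι → M} (hs : ∀ a b, T a b = T b a) (hd : ∀ a, T a a = 0) :
    ∑ a, ∑ b, T a b = ∑ a, ∑ b, if a < b then (2 : ℤ) • T a b else 0 := by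
  have h1 : ∀ a b, T a b = (if a < b then T a b else 0) + if b < a then T b a else 0 := by
    intro a b
    rcases lt_trichotomy a b with h | rfl | h
    · simp [h, h.not_gt]
    · simp [hd]
    · simp [h, h.not_gt, hs a b]
  have h2 : ∀ a b, (if a < b then (2 : ℤ) • T a b else 0) =
      (if a < b then T a b else 0) + if a < b then T a b else 0 := by
    intro a b
    split_ifs <;> simp [two_smul]
  calc ∑ a, ∑ b, T a b
      = ∑ a, ∑ b, ((if a < b then T a b else 0) + if b < a then T b a else 0) := by
        simp only [← h1]
    _ = _ := by
        simp only [h2, Finset.sum_add_distrib]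
        congr 1
        exact Finset.sum_comm

variable {G l} in
theorem linearCombination_sBoundary {M : Type*} [AddCommGroup M] (φ : G.SmoothSimplex l 1 → M)
    (z : G.SChain l 2) :
    Finsupp.linearCombination ℤ φ (G.sBoundary l 1 z) = Finsupp.linearCombination ℤ
      (fun s => φ (s.face 0) - φ (s.face 1) + φ (s.face 2)) z := by
  suffices h : Finsupp.linearCombination ℤ φ ∘ₗ G.sBoundary l 1 = Finsupp.linearCombination ℤ
      (fun s => φ (s.face 0) - φ (s.face 1) + φ (s.face 2)) from LinearMap.congr_fun h z
  refine Finsupp.lhom_ext' fun s => LinearMap.ext_ring ?_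
  simp only [LinearMap.comp_apply, Finsupp.lsingle_apply]
  rw [sBoundary_single, Fin.sum_univ_three]
  simp [sub_eq_add_neg]

variable [Finite E]

/-- The left side is the Θ-value of a parallelogram with sides `p` and `q` cut along its diagonal;
it serves for tori and for prisms. -/
theorem ιMulti_sub_eq_two_smul {A : Type*} [CommRing A] (n p q : G.NExt A) :
    exteriorPower.ιMulti A 3 ![n, p, p + q] - exteriorPower.ιMulti A 3 ![n, q, p + q] =
      (2 : ℤ) • exteriorPower.ιMulti A 3 ![n, p, q] := by
  refine (G.basisWedge A).repr.injective (Finsupp.ext fun s => ?_)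
  rw [map_sub, map_zsmul, Finsupp.sub_apply, Finsupp.smul_apply]
  simp only [basisWedge_repr_ιMulti, Matrix.det_fin_three, Matrix.of_apply, Matrix.cons_val_zero,
    Matrix.cons_val_one, Matrix.cons_val, LinearMap.add_apply, zsmul_eq_mul]
  push_cast
  ring

/-- The period of the torus spanned by two elements of the lattice. -/
theorem two_smul_wedge_mem_periods (n : G.N) (γ γ' : G.H₁) :
    (2 : ℤ) • exteriorPower.ιMulti G.R 3
      ![G.incl G.R n, G.projU (γ : E →₀ ℤ), G.projU (γ' : E →₀ ℤ)] ∈ G.periods := by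
  set p := G.projU (γ : E →₀ ℤ)
  set q := G.projU (γ' : E →₀ ℤ)
  have hp : p ∈ G.latticeU := ⟨γ, rfl⟩
  have hq : q ∈ G.latticeU := ⟨γ', rfl⟩
  -- The two halves of the parallelogram share the diagonal, and its opposite sides are identified
  -- by translation by `p` and `q`.
  refine ⟨n ⊗ₜ Finsupp.single (G.simplex ![0, p, p + q]) 1
    - n ⊗ₜ Finsupp.single (G.simplex ![0, q, p + q]) 1, ?_, ?_⟩
  · change G.tBoundary 1 _ = 0
    have e1 : G.simplex (![0, p, p + q] ∘ Fin.succAbove 0) = G.simplex ![0, q] :=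
      (G.simplex_eq_of_translate hp fun i => by fin_cases i <;> simp [add_comm]).symm
    have e2 : G.simplex (![0, q, p + q] ∘ Fin.succAbove 0) = G.simplex ![0, p] :=
      (G.simplex_eq_of_translate hq fun i => by fin_cases i <;> simp).symm
    have e3 : ![0, p, p + q] ∘ Fin.succAbove 1 = ![0, p + q] := by
      ext i : 1; fin_cases i <;> rfl
    have e4 : ![0, q, p + q] ∘ Fin.succAbove 1 = ![0, p + q] := by
      ext i : 1; fin_cases i <;> rfl
    have e5 : ![0, p, p + q] ∘ Fin.succAbove 2 = ![0, p] := by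
      ext i : 1; fin_cases i <;> rfl
    have e6 : ![0, q, p + q] ∘ Fin.succAbove 2 = ![0, q] := by
      ext i : 1; fin_cases i <;> rfl
    rw [map_sub, tBoundary_tmul, tBoundary_tmul, ← TensorProduct.tmul_sub, boundary_single,
      boundary_single, Fin.sum_univ_three, Fin.sum_univ_three]
    simp only [face_simplex, e1, e2, e3, e4, e5, e6]
    rw [← TensorProduct.tmul_zero _ n]
    congr 1
    simp
    abel
  · rw [map_sub, theta_tmul_simplex, theta_tmul_simplex, ← ιMulti_sub_eq_two_smul]
    simp

/-- Tori supply only even multiples; antisymmetry makes the terms `(a, b)` and `(b, a)` equal, which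
gives the required factor 2. -/
theorem sum_smul_wedge_mem_periods (n : G.N) {c : Fin G.genus → Fin G.genus → ℤ}
    (hc : ∀ a b, c a b = -c b a) :
    ∑ a, ∑ b, c a b • exteriorPower.ιMulti G.R 3 ![G.incl G.R n,
      G.projU (G.cycleBasis a : E →₀ ℤ), G.projU (G.cycleBasis b : E →₀ ℤ)] ∈ G.periods := by
  rw [sum_sum_eq_two_smul_sum_lt]
  · refine sum_mem fun a _ => sum_mem fun b _ => ?_
    split_ifs
    · rw [smul_comm]
      exact zsmul_mem (G.two_smul_wedge_mem_periods n _ _) _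
    · exact zero_mem _
  · intro a b
    have hw : ∀ p q : G.NR, exteriorPower.ιMulti G.R 3 ![G.incl G.R n, p, q] =
        -exteriorPower.ιMulti G.R 3 ![G.incl G.R n, q, p] := by
      intro p q
      rw [← AlternatingMap.map_swap _ _ (show (1 : Fin 3) ≠ 2 by decide)]
      congr 1
      ext i : 1
      fin_cases i <;> rfl
    rw [hc a b, hw]
    simp
  · intro a
    have : c a a = 0 := by have := hc a a; omega
    simp [this]

variable {G l}

/-- The coordinates of the period of a smooth edge. -/
def edgeCoord (a : Fin G.genus) (s : G.SmoothSimplex l 1) : ℤ :=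
  G.cycleBasis.repr (edgePeriod s) a

/-- The coefficients of the homology class of a two-cycle. -/
def cupCoeff (z : G.SChain l 2) (a b : Fin G.genus) : ℤ :=
  Finsupp.linearCombination ℤ (fun s => edgeCoord a (s.face 2) * edgeCoord b (s.face 0)) z

theorem edgeCoord_face_one (a : Fin G.genus) (s : G.SmoothSimplex l 2) :
    edgeCoord a (s.face 1) = edgeCoord a (s.face 0) + edgeCoord a (s.face 2) := by
  rw [edgeCoord, edgePeriod_face_one, map_add]
  rfl

/-- For cocycles `x` and `y`, the coboundary of the pointwise product is `-(x ∪ y + y ∪ x)`, and it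
pairs to zero with a cycle. -/
theorem cupCoeff_antisymm {z : G.SChain l 2} (hz : G.sBoundary l 1 z = 0) (a b : Fin G.genus) :
    cupCoeff z a b = -cupCoeff z b a := by
  have h := linearCombination_sBoundary (fun s => edgeCoord a s * edgeCoord b s) z
  rw [hz, map_zero] at h
  simp only [edgeCoord_face_one] at h
  have hsum : cupCoeff z a b + cupCoeff z b a + Finsupp.linearCombination ℤ
      (fun s : G.SmoothSimplex l 2 => edgeCoord a (s.face 0) * edgeCoord b (s.face 0)
        - (edgeCoord a (s.face 0) + edgeCoord a (s.face 2)) *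
          (edgeCoord b (s.face 0) + edgeCoord b (s.face 2))
        + edgeCoord a (s.face 2) * edgeCoord b (s.face 2)) z = 0 := by
    simp only [cupCoeff, Finsupp.linearCombination_apply, Finsupp.sum, smul_eq_mul,
      ← Finset.sum_add_distrib]
    exact Finset.sum_eq_zero fun s _ => by ring
  rw [← h, add_zero] at hsum
  linarith

theorem projC_eq_sum_edgeCoord (s : G.SmoothSimplex l 1) (γ : G.H₁) :
    G.projC l (edgePeriod s : E →₀ ℤ) γ =
      ∑ a, (edgeCoord a s : ℝ) * G.projC l (G.cycleBasis a : E →₀ ℤ) γ := by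
  conv_lhs => rw [← G.cycleBasis.sum_repr (edgePeriod s)]
  rw [AddSubmonoidClass.coe_finsetSum, map_sum, LinearMap.sum_apply]
  refine Finset.sum_congr rfl fun a _ => ?_
  rw [Submodule.coe_smul, map_smul, LinearMap.smul_apply, zsmul_eq_mul]
  rfl

/-- The integral of `dz_i ∧ dz_j` over a two-cycle. -/
theorem integral₂_cycle {z : G.SChain l 2} (hz : G.sBoundary l 1 z = 0) (i j : Fin G.genus) :
    Finsupp.linearCombination ℤ (fun s => G.integral₂ l s i j) z =
      ∑ a, ∑ b, (cupCoeff z a b : ℝ) * (G.projC l (G.cycleBasis a : E →₀ ℤ) (G.cycleBasis i) *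
        G.projC l (G.cycleBasis b : E →₀ ℤ) (G.cycleBasis j)) := by
  have h := linearCombination_sBoundary
    (edgeCochain (l := l) (G.cycleBasis i) (G.cycleBasis j)) z
  rw [hz, map_zero] at h
  -- The coboundary of `edgeCochain` is subtracted at no cost, since it pairs to zero with `z`.
  rw [← sub_zero (Finsupp.linearCombination ℤ _ z), h]
  simp only [cupCoeff, Finsupp.linearCombination_apply, Finsupp.sum, smul_eq_mul, zsmul_eq_mul,
    ← Finset.sum_sub_distrib, Int.cast_sum, Int.cast_mul, Finset.sum_mul]
  rw [Finset.sum_congr rfl fun a _ => Finset.sum_comm, Finset.sum_comm]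
  refine Finset.sum_congr rfl fun s _ => ?_
  rw [integral₂_eq_cup, projC_eq_sum_edgeCoord, projC_eq_sum_edgeCoord, ← mul_sub,
    add_sub_cancel_left, Finset.sum_mul_sum, Finset.mul_sum]
  refine Finset.sum_congr rfl fun a _ => ?_
  rw [Finset.mul_sum]
  refine Finset.sum_congr rfl fun b _ => ?_
  ring

theorem sTheta_tmul (n : G.N) (z : G.SChain l 2) :
    G.sTheta l (n ⊗ₜ z) = ∑ I : Fin G.genus × Fin G.genus × Fin G.genus with
      I.1 < I.2.1 ∧ I.2.1 < I.2.2,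
        (2 * ((n (G.cycleBasis I.1) : ℝ) *
            Finsupp.linearCombination ℤ (fun s => G.integral₂ l s I.2.1 I.2.2) z
          - (n (G.cycleBasis I.2.1) : ℝ) *
            Finsupp.linearCombination ℤ (fun s => G.integral₂ l s I.1 I.2.2) z
          + (n (G.cycleBasis I.2.2) : ℝ) *
            Finsupp.linearCombination ℤ (fun s => G.integral₂ l s I.1 I.2.1) z)) •
          G.wedgeBasis I.1 I.2.1 I.2.2 := by
  induction z using Finsupp.induction_linear with
  | zero => rw [TensorProduct.tmul_zero]; simp
  | add x y hx hy =>
    rw [TensorProduct.tmul_add, map_add, hx, hy, ← Finset.sum_add_distrib]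
    refine Finset.sum_congr rfl fun I _ => ?_
    rw [← add_smul]
    congr 1
    simp only [map_add]
    ring
  | single s m =>
    have : (Finsupp.single s m : G.SChain l 2) = m • Finsupp.single s 1 := by simp
    rw [this, TensorProduct.tmul_smul, map_smul, sTheta_tmul_single]
    refine (congrArg (m • ·) (Finset.smul_sum (M := ℝ) (N := G.WedgeReal))).trans ?_
    refine Finset.smul_sum.trans (Finset.sum_congr rfl fun I _ => ?_)
    rw [← Int.cast_smul_eq_zsmul ℝ, smul_smul, smul_smul]
    congr 1
    simp
    ring

theorem sTheta_tmul_cycle (n : G.N) {z : G.SChain l 2} (hz : G.sBoundary l 1 z = 0) :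
    G.sTheta l (n ⊗ₜ z) = ∑ a, ∑ b, cupCoeff z a b • exteriorPower.ιMulti ℝ 3 ![G.incl ℝ n,
      G.projC l (G.cycleBasis a : E →₀ ℤ), G.projC l (G.cycleBasis b : E →₀ ℤ)] := by
  -- Of the two copies of the integral, one has `a` and `b` exchanged by antisymmetry, so that 2×2
  -- minors appear.
  have hI : ∀ i j, 2 * Finsupp.linearCombination ℤ (fun s => G.integral₂ l s i j) z =
      ∑ a, ∑ b, (cupCoeff z a b : ℝ) *
        (G.projC l (G.cycleBasis a : E →₀ ℤ) (G.cycleBasis i) *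
            G.projC l (G.cycleBasis b : E →₀ ℤ) (G.cycleBasis j)
          - G.projC l (G.cycleBasis a : E →₀ ℤ) (G.cycleBasis j) *
            G.projC l (G.cycleBasis b : E →₀ ℤ) (G.cycleBasis i)) := by
    intro i j
    rw [two_mul]
    simp only [mul_sub, Finset.sum_sub_distrib]
    rw [integral₂_cycle hz, sub_eq_add_neg]
    congr 1
    rw [Finset.sum_comm, ← Finset.sum_neg_distrib]
    refine Finset.sum_congr rfl fun a _ => ?_
    rw [← Finset.sum_neg_distrib]
    refine Finset.sum_congr rfl fun b _ => ?_
    rw [cupCoeff_antisymm hz b a]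
    push_cast
    ring
  rw [sTheta_tmul]
  refine Eq.trans ?_ (Finset.sum_congr rfl fun a _ => Finset.sum_congr rfl fun b _ =>
    congrArg (cupCoeff z a b • ·) (G.ιMulti_eq_sum _ _ _).symm)
  simp only [Finset.smul_sum]
  rw [Finset.sum_congr rfl fun a _ => Finset.sum_comm, Finset.sum_comm]
  refine Finset.sum_congr rfl fun I _ => ?_
  simp only [← Int.cast_smul_eq_zsmul ℝ, smul_smul, wedgeBasis, ← Finset.sum_smul]
  congr 1
  rw [mul_add, mul_sub, mul_left_comm, mul_left_comm (2 : ℝ), mul_left_comm (2 : ℝ), hI, hI, hI]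
  simp only [Finset.mul_sum, ← Finset.sum_sub_distrib, ← Finset.sum_add_distrib, incl_apply]
  refine Finset.sum_congr rfl fun a _ => Finset.sum_congr rfl fun b _ => ?_
  ring

theorem sTheta_tmul_cycle_mem (n : G.N) {z : G.SChain l 2} (hz : G.sBoundary l 1 z = 0) :
    ∃ w ∈ G.periods, G.mapWedge (G.evalLength l) w = G.sTheta l (n ⊗ₜ z) := by
  refine ⟨_, G.sum_smul_wedge_mem_periods n (cupCoeff_antisymm hz), ?_⟩
  rw [sTheta_tmul_cycle n hz]
  simp only [map_sum, map_smul, mapWedge_ιMulti]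
  refine Finset.sum_congr rfl fun a _ => Finset.sum_congr rfl fun b _ => ?_
  congr 2
  ext i : 1
  fin_cases i
  · exact G.mapNExt_incl _ n
  · exact G.mapNExt_projU l _
  · exact G.mapNExt_projU l _

/-- Contraction of the coefficients with a basis cycle. -/
def contract (q : ℕ) (i : Fin G.genus) : G.STChain l q →ₗ[ℤ] G.SChain l q :=
  TensorProduct.lift ((LinearMap.lsmul ℤ (G.SChain l q)).comp
    (LinearMap.applyₗ (R := ℤ) (G.cycleBasis i)))

theorem contract_tmul {q : ℕ} (i : Fin G.genus) (n : G.N) (c : G.SChain l q) :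
    contract q i (n ⊗ₜ c) = n (G.cycleBasis i) • c := rfl

theorem sBoundary_contract {q : ℕ} (i : Fin G.genus) (c : G.STChain l (q + 1)) :
    G.sBoundary l q (contract (q + 1) i c) = contract q i (G.stBoundary l q c) := by
  suffices h : G.sBoundary l q ∘ₗ contract (q + 1) i = contract q i ∘ₗ G.stBoundary l q from
    LinearMap.congr_fun h c
  refine tensor_finsupp_hom_ext fun n s => ?_
  rw [LinearMap.comp_apply, LinearMap.comp_apply, stBoundary_tmul, contract_tmul, contract_tmul,
    map_smul]

/-- As `N` is free, a `(1,q)`-chain is a tuple of integral chains; contraction commutes with the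
boundary, so cycles can be treated component by component. -/
theorem sum_tmul_contract {q : ℕ} (c : G.STChain l q) :
    ∑ i, G.cocycleBasis i ⊗ₜ contract q i c = c := by
  induction c using TensorProduct.induction_on with
  | zero => simp only [map_zero, TensorProduct.tmul_zero, Finset.sum_const_zero]
  | add x y hx hy => simp only [map_add, TensorProduct.tmul_add, Finset.sum_add_distrib, hx, hy]
  | tmul n c =>
    simp only [contract_tmul, ← TensorProduct.smul_tmul, ← TensorProduct.sum_tmul]
    congr 1
    refine G.cycleBasis.ext fun j => ?_
    simp [cocycleBasis]

-- Specialization preserves cycles, which gives one inclusion. For the other, each component of a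
-- smooth cycle has the value of a combination of universal tori.
variable (G l) in
theorem mem_tropicalPeriods_iff (w : G.WedgeReal) :
    w ∈ G.tropicalPeriods l ↔ ∃ w' ∈ G.periods, G.mapWedge (G.evalLength l) w' = w := by
  constructor
  · rintro ⟨c, hc, rfl⟩
    have hc' : G.stBoundary l 1 c = 0 := hc
    have hz : ∀ i, G.sBoundary l 1 (contract 2 i c) = 0 := fun i => by
      rw [sBoundary_contract, hc', map_zero]
    choose w hw hw' using fun i => sTheta_tmul_cycle_mem (G.cocycleBasis i) (hz i)
    refine ⟨∑ i, w i, sum_mem fun i _ => hw i, ?_⟩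
    conv_rhs => rw [← sum_tmul_contract c]
    rw [map_sum, map_sum]
    exact Finset.sum_congr rfl fun i _ => hw' i
  · rintro ⟨w', hw', rfl⟩
    exact G.mapWedge_mem_tropicalPeriods l hw'

end Periods

/-! ### Independence of the base point -/

section BasePoint

theorem boundary₁_single (e : E) :
    G.boundary₁ (Finsupp.single e 1) =
      Finsupp.single (G.head e) 1 - Finsupp.single (G.tail e) 1 := by
  simp [boundary₁]

variable {G} in
theorem IsPath.boundary₁_eq {a b : V} {δ : E →₀ ℤ} (h : G.IsPath a b δ) :
    G.boundary₁ δ = Finsupp.single b 1 - Finsupp.single a 1 := by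
  induction h with
  | nil => simp
  | forward e _ ih => simp [map_add, ih, boundary₁_single]
  | backward e _ ih => simp [map_sub, ih, boundary₁_single]

variable {G} in
theorem Connected.exists_isPath (hG : G.Connected) (a b : V) : ∃ δ, G.IsPath a b δ := by
  suffices h : ∀ p q, Relation.EqvGen (fun p q => ∃ e, G.tail e = p ∧ G.head e = q) p q →
      ((∃ δ, G.IsPath a p δ) ↔ ∃ δ, G.IsPath a q δ) from
    (h a b (hG.2 a b)).1 ⟨0, IsPath.nil⟩
  intro p q hpq
  induction hpq with
  | rel p q h =>
    obtain ⟨e, rfl, rfl⟩ := h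
    exact ⟨fun ⟨δ, h⟩ => ⟨_, h.forward e⟩, fun ⟨δ, h⟩ => ⟨_, h.backward e⟩⟩
  | refl p => exact Iff.rfl
  | symm p q _ ih => exact ih.symm
  | trans p q r _ _ ih ih' => exact ih.trans ih'

variable {G} in
theorem Connected.boundary₁_path (hG : G.Connected) (a b : V) :
    G.boundary₁ (G.path a b) = Finsupp.single b 1 - Finsupp.single a 1 := by
  have h := hG.exists_isPath a b
  rw [path, dif_pos h]
  exact h.choose_spec.boundary₁_eq

theorem projC_mem_lattice {c : E →₀ ℤ} (hc : G.boundary₁ c = 0) : G.projC l c ∈ G.lattice l.1 :=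
  mem_lattice_iff.2 ⟨⟨c, hc⟩, rfl⟩

/-- The edge classes satisfy Kirchhoff's law: their signed sum at every vertex vanishes. -/
theorem sum_edgeClass_tmul [Fintype V] [Fintype E] {M : Type*} [AddCommGroup M] (h : V → M) :
    ∑ e, G.edgeClass e ⊗ₜ[ℤ] (h (G.head e) - h (G.tail e)) = 0 := by
  classical
  -- Collected by vertices, the coefficient of `h b` is the functional sending `γ` to the
  -- multiplicity of `b` in its boundary, which is zero.
  have hh : ∀ e, h (G.head e) - h (G.tail e) =
      ∑ b, ((if G.head e = b then 1 else 0) - (if G.tail e = b then 1 else 0) : ℤ) • h b := by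
    intro e
    simp [sub_smul, Finset.sum_sub_distrib]
  simp only [hh, TensorProduct.tmul_sum, ← TensorProduct.smul_tmul]
  rw [Finset.sum_comm]
  refine Finset.sum_eq_zero fun b _ => ?_
  rw [← TensorProduct.sum_tmul]
  convert TensorProduct.zero_tmul G.N (h b)
  ext γ
  have hγ : G.boundary₁ (γ : E →₀ ℤ) b = 0 := by
    rw [show G.boundary₁ (γ : E →₀ ℤ) = 0 from γ.2]; rfl
  rw [boundary₁, Finsupp.linearCombination_apply, Finsupp.sum_fintype _ _ (by simp),
    Finsupp.finsetSum_apply] at hγ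
  rw [LinearMap.sum_apply, LinearMap.zero_apply]
  refine Eq.trans (Finset.sum_congr rfl fun e _ => ?_) hγ
  simp [edgeClass, Finsupp.single_apply, mul_comm]

theorem stBoundary_sNegPush (q : ℕ) (c : G.STChain l (q + 1)) :
    G.stBoundary l q (G.sNegPush l (q + 1) c) = G.sNegPush l q (G.stBoundary l q c) := by
  suffices h : G.stBoundary l q ∘ₗ G.sNegPush l (q + 1) = G.sNegPush l q ∘ₗ G.stBoundary l q from
    LinearMap.congr_fun h c
  refine tensor_finsupp_hom_ext fun n s => ?_
  rw [LinearMap.comp_apply, LinearMap.comp_apply, sNegPush_tmul_single, map_neg, stBoundary_tmul,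
    stBoundary_tmul, sBoundary_single, sBoundary_single, TensorProduct.tmul_sum,
    TensorProduct.tmul_sum, map_sum, ← Finset.sum_neg_distrib]
  refine Finset.sum_congr rfl fun i _ => ?_
  rw [TensorProduct.tmul_smul, TensorProduct.tmul_smul, map_smul, sNegPush_tmul_single, smul_neg]
  rfl

/-- The square with edges `y - x` and `w`, with coefficient `n`, divided into two triangles. -/
def prism (n : G.N) (x y w : G.NReal) : G.STChain l 2 :=
  n ⊗ₜ Finsupp.single (SmoothSimplex.affine l ![x, y, y + w]) 1
    - n ⊗ₜ Finsupp.single (SmoothSimplex.affine l ![x, x + w, y + w]) 1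

/-- The first summand is a difference of walls over the two ends, in the form cancelled by
`sum_edgeClass_tmul`; the second is the edge minus its translate. -/
theorem stBoundary_prism (n : G.N) (x y w : G.NReal) :
    G.stBoundary l 1 (G.prism l n x y w) =
      n ⊗ₜ (Finsupp.single (SmoothSimplex.affine l ![y, y + w]) 1
        - Finsupp.single (SmoothSimplex.affine l ![x, x + w]) 1)
      + (n ⊗ₜ Finsupp.single (SmoothSimplex.affine l ![x, y]) 1
        - n ⊗ₜ Finsupp.single (SmoothSimplex.affine l ![x + w, y + w]) 1) := by
  have e : ∀ a b c : G.NReal, ![a, b, c] ∘ Fin.succAbove 0 = ![b, c] ∧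
      ![a, b, c] ∘ Fin.succAbove 1 = ![a, c] ∧ ![a, b, c] ∘ Fin.succAbove 2 = ![a, b] := by
    intro a b c
    refine ⟨?_, ?_, ?_⟩ <;> · ext i : 1; fin_cases i <;> rfl
  rw [prism, map_sub, stBoundary_tmul, stBoundary_tmul, ← TensorProduct.tmul_sub,
    ← TensorProduct.tmul_sub, ← TensorProduct.tmul_add, sBoundary_single, sBoundary_single,
    Fin.sum_univ_three, Fin.sum_univ_three]
  congr 1
  simp only [face_affine, e]
  simp
  abel

section Theta

variable [Finite E]

/-- The value is `2 n ∧ (y - x) ∧ w`, and `y - x` is parallel to `n`. -/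
theorem sTheta_prism {n : G.N} {x y w : G.NReal} {t : ℝ} (h : y - x = t • G.incl ℝ n) :
    G.sTheta l (G.prism l n x y w) = 0 := by
  have h0 : exteriorPower.ιMulti ℝ 3 ![G.incl ℝ n, y - x, w] = 0 := by
    refine (G.basisWedge ℝ).repr.injective (Finsupp.ext fun s => ?_)
    rw [basisWedge_repr_ιMulti, map_zero, Matrix.det_fin_three]
    simp [h]
    ring
  rw [prism, map_sub, sTheta_tmul_single, sTheta_tmul_single, sThetaSimplex_affine,
    sThetaSimplex_affine]
  have := G.ιMulti_sub_eq_two_smul (G.incl ℝ n) (y - x) w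
  rw [h0, smul_zero] at this
  rw [← this]
  simp [sub_add_eq_add_sub]

/-- The coefficient and both edge vectors change sign, three signs in all. -/
theorem sTheta_sNegPush_affine (n : G.N) (x : Fin 3 → G.NReal) :
    G.sTheta l (G.sNegPush l 2 (n ⊗ₜ Finsupp.single (SmoothSimplex.affine l x) 1)) =
      -G.sTheta l (n ⊗ₜ Finsupp.single (SmoothSimplex.affine l x) 1) := by
  rw [sNegPush_tmul_single, map_neg, sTheta_tmul_single, sTheta_tmul_single, neg_affine,
    sThetaSimplex_affine, sThetaSimplex_affine]
  congr 1
  refine (G.basisWedge ℝ).repr.injective (Finsupp.ext fun s => ?_)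
  rw [basisWedge_repr_ιMulti, basisWedge_repr_ιMulti, Matrix.det_fin_three, Matrix.det_fin_three]
  simp
  ring

end Theta

variable {G} in
/-- The Abel–Jacobi maps for two base points differ by a translation, up to the lattice. -/
theorem sAbelJacobiEdge_eq (hG : G.Connected) (a : V) (p : G.CurvePoint l) (e : E) :
    G.sAbelJacobiEdge l p e = G.edgeClass e ⊗ₜ Finsupp.single (SmoothSimplex.affine l
      ![G.projC l (G.path a (G.tail e)) + G.abelJacobiLift l p a,
        G.projC l (G.path a (G.tail e)) + G.projC l (Finsupp.single e 1)
          + G.abelJacobiLift l p a]) 1 := by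
  rw [sAbelJacobiEdge]
  congr 2
  refine (affine_eq_of_translate l (c := G.projC l (G.path p.root (G.tail e)
    - G.path p.root a - G.path a (G.tail e))) (G.projC_mem_lattice l ?_) fun i => ?_).symm
  · simp [map_sub, hG.boundary₁_path]
  · fin_cases i
    · simp [abelJacobiLift]
      abel
    · simp [abelJacobiLift]
      abel

variable {G} in
/-- A bounding chain of the Ceresa cycle for one base point yields a bounding chain with the same
integral for any other base point. -/
theorem exists_bounding_chain [Fintype V] [Fintype E] (hG : G.Connected) (a : V)
    (p : G.CurvePoint l) {S : G.STChain l 2}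
    (hS : G.stBoundary l 1 S = G.tropicalCeresaCycle l (CurvePoint.vertex a)) :
    ∃ S', G.stBoundary l 1 S' = G.tropicalCeresaCycle l p ∧ G.sTheta l S' = G.sTheta l S := by
  set w := G.abelJacobiLift l p a
  set x : V → G.NReal := fun b => G.projC l (G.path a b)
  set y : E → G.NReal := fun e => x (G.tail e) + G.projC l (Finsupp.single e 1)
  set P := ∑ e, G.prism l (G.edgeClass e) (x (G.tail e)) (y e) w
  -- Both `y e` and `x (G.head e)` lift the head of `e`, along paths that differ by a cycle, so the
  -- wall depends only on the vertex.
  have hside : ∀ e, SmoothSimplex.affine l ![y e, y e + w] =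
      SmoothSimplex.affine l ![x (G.head e), x (G.head e) + w] := by
    intro e
    refine affine_eq_of_translate l (c := G.projC l (G.path a (G.head e)
      - G.path a (G.tail e) - Finsupp.single e 1)) (G.projC_mem_lattice l ?_) fun i => ?_
    · simp [map_sub, hG.boundary₁_path, boundary₁_single]
    · fin_cases i
      · simp [x, y]
      · simp [x, y]
        abel
  have hP : G.stBoundary l 1 P = ∑ e, G.sAbelJacobiEdge l (CurvePoint.vertex a) e
      - ∑ e, G.sAbelJacobiEdge l p e := by
    have hv : ∀ e, G.sAbelJacobiEdge l (CurvePoint.vertex a) e =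
        G.edgeClass e ⊗ₜ Finsupp.single (SmoothSimplex.affine l ![x (G.tail e), y e]) 1 := by
      intro e
      simp [sAbelJacobiEdge, abelJacobiLift, CurvePoint.offset, CurvePoint.root, x, y]
    rw [map_sum, Finset.sum_congr rfl fun e _ => G.stBoundary_prism l _ _ _ _,
      Finset.sum_add_distrib, ← Finset.sum_sub_distrib]
    simp only [hside, hv, sAbelJacobiEdge_eq l hG a p]
    rw [G.sum_edgeClass_tmul
      (fun b => (Finsupp.single (SmoothSimplex.affine l ![x b, x b + w]) 1 : G.SChain l 1)),
      zero_add]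
  have hxy : ∀ e, y e - x (G.tail e) = l.1 e • G.incl ℝ (G.edgeClass e) := by
    intro e
    rw [smul_incl_edgeClass]
    simp [y]
  refine ⟨S - (P - G.sNegPush l 2 P), ?_, ?_⟩
  · rw [map_sub, map_sub, stBoundary_sNegPush, hP, hS, tropicalCeresaCycle, tropicalCeresaCycle,
      map_sub]
    abel
  · have h1 : G.sTheta l P = 0 := by
      rw [map_sum]
      exact Finset.sum_eq_zero fun e _ => G.sTheta_prism l (hxy e)
    have h2 : G.sTheta l (G.sNegPush l 2 P) = -G.sTheta l P := by
      rw [map_sum, map_sum, map_sum, ← Finset.sum_neg_distrib]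
      refine Finset.sum_congr rfl fun e _ => ?_
      rw [prism, map_sub, map_sub, map_sub, sTheta_sNegPush_affine, sTheta_sNegPush_affine]
      abel
    rw [map_sub, map_sub, h2, h1]
    simp

end BasePoint

/-! ### Vanishing of the Ceresa period -/

section Vanishing

variable {G} in
/-- A property that fails only where one of countably many nonzero integral polynomials vanishes
is very general. -/
theorem veryGeneral_of_polynomials {P : G.Length → Prop} (f : ℕ → MvPolynomial E ℤ)
    (hf : ∀ n, f n ≠ 0) (h : ∀ l : G.Length, ¬ P l → ∃ n, MvPolynomial.aeval l.1 (f n) = 0) :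
    G.VeryGeneral P := by
  have hev : ∀ (l : G.Length) n, MvPolynomial.eval l.1
      (MvPolynomial.map (Int.castRingHom ℝ) (f n)) = MvPolynomial.aeval l.1 (f n) := by
    intro l n
    rw [MvPolynomial.eval_map]
    rfl
  -- Constant polynomials define no hypersurface; they can be dropped because a nonzero constant
  -- vanishes nowhere.
  refine ⟨{Z | ∃ n, (MvPolynomial.map (Int.castRingHom ℝ) (f n)).totalDegree ≠ 0 ∧
    Z = G.toModuli '' {l | MvPolynomial.eval l.1
      (MvPolynomial.map (Int.castRingHom ℝ) (f n)) = 0}}, ?_, ?_, ?_⟩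
  · refine (Set.countable_range fun n => G.toModuli '' {l | MvPolynomial.eval l.1
      (MvPolynomial.map (Int.castRingHom ℝ) (f n)) = 0}).mono ?_
    rintro Z ⟨n, -, rfl⟩
    exact ⟨n, rfl⟩
  · rintro Z ⟨n, hn, rfl⟩
    exact ⟨_, hn, rfl⟩
  · intro l hl
    by_contra hP
    obtain ⟨n, hn⟩ := h l hP
    rw [← hev] at hn
    refine hl ⟨_, ⟨n, fun hd => ?_, rfl⟩, l, hn, rfl⟩
    have hC := MvPolynomial.totalDegree_eq_zero_iff_eq_C.1 hd
    rw [hC, MvPolynomial.eval_C] at hn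
    rw [hn, MvPolynomial.C_0] at hC
    exact hf n (MvPolynomial.map_injective _ Int.cast_injective (by rw [hC, map_zero]))

variable [Fintype E]

/-- Two bounding chains differ by a cycle, so any one of them can replace the chosen one. -/
theorem tropicalCeresaPeriod_eq_zero_iff {p : G.CurvePoint l} {S : G.STChain l 2}
    (hS : G.stBoundary l 1 S = G.tropicalCeresaCycle l p) :
    G.tropicalCeresaPeriod l p = 0 ↔ G.sTheta l S ∈ G.tropicalPeriods l := by
  have h : ∃ S, G.stBoundary l 1 S = G.tropicalCeresaCycle l p := ⟨S, hS⟩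
  rw [tropicalCeresaPeriod, dif_pos h, QuotientAddGroup.eq_zero_iff]
  have hd : G.sTheta l h.choose - G.sTheta l S ∈ G.tropicalPeriods l := by
    refine ⟨h.choose - S, ?_, map_sub _ _ _⟩
    change G.stBoundary l 1 _ = 0
    rw [map_sub, h.choose_spec, hS, sub_self]
  constructor
  · intro h'
    simpa using sub_mem h' hd
  · intro h'
    simpa using add_mem hd h'

variable {G}

/-- The period is 0 by default when nothing bounds the Ceresa cycle, so nonvanishing itself supplies
a bounding chain. -/
theorem exists_of_ceresaPeriod_ne_zero {a : V} (hα : G.ceresaPeriod a ≠ 0) :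
    ∃ S, G.tBoundary 1 S = G.ceresaCycle a ∧ G.theta S ∉ G.periods := by
  by_cases h : ∃ S : G.TChain 2, G.tBoundary 1 S = G.ceresaCycle a
  · refine ⟨h.choose, h.choose_spec, fun h' => hα ?_⟩
    rw [ceresaPeriod, dif_pos h, QuotientAddGroup.eq_zero_iff]
    exact h'
  · exact absurd (by rw [ceresaPeriod, dif_neg h]) hα

theorem tropicalCeresaPeriod_eq_zero_iff_exists [Fintype V] (hG : G.Connected) {a : V}
    {S : G.TChain 2} (hS : G.tBoundary 1 S = G.ceresaCycle a) (p : G.CurvePoint l) :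
    G.tropicalCeresaPeriod l p = 0 ↔ ∃ w ∈ G.periods,
      ∀ s, MvPolynomial.aeval l.1 ((G.basisWedge G.R).repr (G.theta S - w) s) = 0 := by
  obtain ⟨S', hS', hθ⟩ := exists_bounding_chain l hG a p (S := G.specialize l 2 S)
    (by rw [stBoundary_specialize, hS, specialize_ceresaCycle])
  rw [G.tropicalCeresaPeriod_eq_zero_iff l hS', hθ, sTheta_specialize, mem_tropicalPeriods_iff]
  refine exists_congr fun w => and_congr_right fun _ => ?_
  rw [eq_comm, ← sub_eq_zero, ← map_sub]
  exact G.mapWedge_eq_zero_iff _ _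

instance : Countable G.WedgeR := by
  have : Countable G.R := (MvPolynomial.basisMonomials E ℤ).repr.injective.countable
  exact (G.basisWedge G.R).repr.injective.countable

/-- The polynomial conditions for the vanishing of the Ceresa period. -/
theorem exists_vanishing_polynomials [Fintype V] (hG : G.Connected) {a : V}
    (hα : G.ceresaPeriod a ≠ 0) :
    ∃ F : ℕ → Finset (MvPolynomial E ℤ), (∀ n, ∃ f ∈ F n, f ≠ 0) ∧
      ∀ (l : G.Length) (p : G.CurvePoint l),
        G.tropicalCeresaPeriod l p = 0 ↔ ∃ n, ∀ f ∈ F n, MvPolynomial.aeval l.1 f = 0 := by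
  classical
  obtain ⟨S, hS, hθ⟩ := exists_of_ceresaPeriod_ne_zero hα
  obtain ⟨q, hq⟩ := exists_surjective_nat G.periods
  -- The set `F n` holds the coordinates of `Θ(S) - w`, where `w = q n` runs through the countable
  -- group of periods.
  refine ⟨fun n => Finset.univ.image fun s =>
    (G.basisWedge G.R).repr (G.theta S - (q n : G.WedgeR)) s, fun n => ?_, fun l p => ?_⟩
  · by_contra! h
    have h0 : G.theta S - (q n : G.WedgeR) = 0 :=
      (G.basisWedge G.R).repr.map_eq_zero_iff.1
        (Finsupp.ext fun s => h _ (Finset.mem_image_of_mem _ (Finset.mem_univ s)))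
    exact hθ (by rw [sub_eq_zero.1 h0]; exact (q n).2)
  · rw [tropicalCeresaPeriod_eq_zero_iff_exists l hG hS]
    constructor
    · rintro ⟨w, hw, h⟩
      obtain ⟨n, hn⟩ := hq ⟨w, hw⟩
      refine ⟨n, fun f hf => ?_⟩
      obtain ⟨s, -, rfl⟩ := Finset.mem_image.1 hf
      rw [hn]
      exact h s
    · rintro ⟨n, h⟩
      exact ⟨q n, (q n).2, fun s => h _ (Finset.mem_image_of_mem _ (Finset.mem_univ s))⟩

end Vanishing

end Multigraph

end CeresaPeriod

end

theorem mainTheorem5 {V : Type*} {E : Type*} [Fintype V] [Fintype E]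
    (G : CeresaPeriod.Multigraph V E) (hG : G.Connected)
    (a : V) (hα : G.ceresaPeriod a ≠ 0) :
    G.VeryGeneral (fun l => ∀ p : G.CurvePoint l, G.tropicalCeresaPeriod l p ≠ 0) ∧
    ∃ F : ℕ → Finset (MvPolynomial E ℤ), (∀ n, ∃ f ∈ F n, f ≠ 0) ∧
      ∀ (l : G.Length) (p : G.CurvePoint l),
        G.tropicalCeresaPeriod l p = 0 ↔ ∃ n, ∀ f ∈ F n, MvPolynomial.aeval l.1 f = 0 := by
  obtain ⟨F, hF, h⟩ := CeresaPeriod.Multigraph.exists_vanishing_polynomials hG hα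
  refine ⟨?_, F, hF, h⟩
  -- One nonzero member of each `F n` suffices: it vanishes wherever all of `F n` does.
  choose f hf hf0 using hF
  refine CeresaPeriod.Multigraph.veryGeneral_of_polynomials f hf0 fun l hl => ?_
  push Not at hl
  obtain ⟨p, hp⟩ := hl
  obtain ⟨n, hn⟩ := (h l p).1 hp
  exact ⟨n, hn _ (hf n)⟩
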